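/- **Conventions.** For $n\ge 1$ let the $n$-spiral be the set $S_n=\{l,r\}\times\mathbb{Z}/n!\;\cup\;\{m\}\times\{-n+1,\dots,n-1\}$ with the relation $R_n$ given by: $(l,k)\,R_n\,(l,k+1)$ and $(r,k)\,R_n\,(r,k+1)$ for $k\in\mathbb{Z}/n!$; $(m,k)\,R_n\,(m,k+1)$ for $-n+1\le k<n-1$; $(l,-n \bmod n!)\,R_n\,(m,-n+1)$; and $(m,n-1)\,R_n\,(r,n \bmod n!)$. Define $\xi_L,\xi_G,\xi_M:S_{n+1}\to S_n$ by $\xi_L(a,k)=(l,k \bmod n!)$, $\xi_G(a,k)=(r,k\bmod n!)$, and $\xi_M(a,k)=(a,k\bmod n!)$ for $a\in\{l,r\}$, $\xi_M(m,k)=(m,k)$ for $|k|<n$, $\xi_M(m,-n)=(l,-n\bmod n!)$, $\xi_M(m,n)=(r,n\bmod n!)$. Let $W_n$ be the discrete space that is the disjoint union of $6^n$ $n$-spirals indexed by the words of length $n$ in the letters $\xi_{L_1},\xi_{L_2},\xi_{M_1},\xi_{M_2},\xi_{G_1},\xi_{G_2}$, with $R_n$ the union of the relations of these spirals. The map $\xi:W_{n+1}\to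 W_n$ removes the last letter of the word and applies the corresponding one of $\xi_L,\xi_M,\xi_G$; its composites $W_{n+k}\to W_n$ are also denoted $\xi$. For a homeomorphism $\sigma$ of a compact space $X$, $\phi:(X,\sigma)\to(W_n,R_n)$ means a continuous surjection $\phi:X\to W_n$ with $\phi(x)\,R_n\,\phi(\sigma(x))$ for all $x\in X$, and $A_\phi=\{\phi^{-1}\{w\}: w\in W_n\}$. If $X$ is a Cantor set with a compatible metric, $(X,\sigma)$ has the *lifting property* if there is some $\phi:(X,\sigma)\to(W_n,R_n)$ with $n\ge1$, and for all $\epsilon>0$, $n\ge 1$ and $\phi:(X,\sigma)\to(W_n,R_n)$ there are $k\ge1$ and $\psi:(X,\sigma)\to(W_{n+k},R_{n+k})$ such that every member of $A_\psi$ has diameter less than $\epsilon$ and $\phi=\xi\circ\psi$. For a compact Hausdorff space $X$ in general, $(X,\sigma)$ has the *lifting property* if there is some $\phi:(X,\sigma)\to(W_n,R_n)$ with $n\ge1$, and for all $n\ge1$, $\phi:(X,\sigma)\to(W_n,R_n)$ and every partition $A$ of $X$ into nonempty clopen sets refining $A_\phi$ there are $k\ge1$ and $\psi:(X,\sigma)\to(W_{n+k},R_{n+k})$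 such that $A_\psi$ refines $A$ and $\phi=\xi\circ\psi$. (The two definitions agree on Cantor sets.) A homeomorphism $\sigma$ of $X$ induces the automorphism $f\mapsto f\circ\sigma$ of the C*-algebra $C(X)$ of complex continuous functions, also denoted $\sigma$. The ultrapower $(C(X),\sigma)^{\mathcal U}$ is the C*-algebra of bounded sequences in $C(X)$ modulo the sequences with $\lim_{\mathcal U}\|f_n\|=0$, with the automorphism $[f_n]\mapsto[\sigma(f_n)]$. A C*-algebra with automorphism $(A,\alpha)$ corresponds to $(Y,\tau)$ if it is isomorphic to $(C(Y),\tau)$. $T_{\mathrm{Cantor}\text{-}A}$ is the theory, in the continuous logic of unital C*-algebras with a function symbol for an automorphism, whose models are the pairs $(C(X),\sigma)$ with $X$ a nonempty compact zero-dimensional Hausdorff space without isolated points and $\sigma$ a homeomorphism of $X$. **Theorem.** Let $\sigma$ be a homeomorphism of a Cantor set $X$ such that $(X,\sigma)$ has the lifting property. Then for every nonprincipal ultrafilter $\mathcal U$ on $\mathbb N$, the ultrapower $(C(X),\sigma)^{\mathcal U}$ corresponds to a system $(Y,\tau)$, with $Y$ compact Hausdorff, zero-dimensional and without isolated points, that does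 not have the lifting property; moreover no system $(Y,\tau)$ on a compact Hausdorff space to which the ultrapower corresponds has the lifting property. **Corollary.** The lifting property is not axiomatizable over $T_{\mathrm{Cantor}\text{-}A}$: there is no set $T$ of sentences of continuous logic in the language of unital C*-algebras with an automorphism such that, for every model $(C(X),\sigma)$ of $T_{\mathrm{Cantor}\text{-}A}$, one has $(C(X),\sigma)\models T$ if and only if $(X,\sigma)$ has the lifting property. -/

import Mathlib

universe u v

open Filter Topology
open scoped BoundedContinuousFunction

noncomputable section

namespace CantorDynamics

/-! ### Spirals -/

/-- The set underlying the `n`-spiral: a left cycle and a right cycle of length `n!`, and a middle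
segment of `2n - 1` points indexed by the integers `-n < k < n`. -/
inductive Spiral (n : ℕ) : Type
  | l (k : ZMod n.factorial) : Spiral n
  | m (k : Set.Ioo (-(n : ℤ)) (n : ℤ)) : Spiral n
  | r (k : ZMod n.factorial) : Spiral n

/-- The relation of the `n`-spiral. Both cycles and the middle segment are traversed in increasing
order; the segment is entered from the point `-n mod n!` of the left cycle, and it leads to the
point `n mod n!` of the right cycle. -/
inductive Spiral.Rel (n : ℕ) : Spiral n → Spiral n → Prop
  | left (k : ZMod n.factorial) : Spiral.Rel n (.l k) (.l (k + 1))
  | right (k : ZMod n.factorial) : Spiral.Rel n (.r k) (.r (k + 1))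
  | middle (k k' : Set.Ioo (-(n : ℤ)) (n : ℤ)) (h : (k' : ℤ) = (k : ℤ) + 1) :
      Spiral.Rel n (.m k) (.m k')
  | enter (k : Set.Ioo (-(n : ℤ)) (n : ℤ)) (h : (k : ℤ) = -(n : ℤ) + 1) :
      Spiral.Rel n (.l (-(n : ZMod n.factorial))) (.m k)
  | exit (k : Set.Ioo (-(n : ℤ)) (n : ℤ)) (h : (k : ℤ) = (n : ℤ) - 1) :
      Spiral.Rel n (.m k) (.r (n : ZMod n.factorial))

/-- Reduction of residues modulo `(n+1)!` to residues modulo `n!`. -/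
def residue (n : ℕ) : ZMod (n + 1).factorial →+* ZMod n.factorial :=
  ZMod.castHom (Nat.factorial_dvd_factorial n.le_succ) (ZMod n.factorial)

/-- The position `k mod n!` of a point `(a, k)` of the `(n+1)`-spiral. -/
def Spiral.position {n : ℕ} : Spiral (n + 1) → ZMod n.factorial
  | .l k => residue n k
  | .m k => ((k : ℤ) : ZMod n.factorial)
  | .r k => residue n k

/-- `ξ_L (a, k) = (l, k mod n!)`. -/
def Spiral.xiL {n : ℕ} (x : Spiral (n + 1)) : Spiral n := .l x.position

/-- `ξ_G (a, k) = (r, k mod n!)`. -/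
def Spiral.xiG {n : ℕ} (x : Spiral (n + 1)) : Spiral n := .r x.position

/-- `ξ_M` projects the `(n+1)`-spiral straight down to the `n`-spiral: the two additional points
`(m, -n)` and `(m, n)` of the middle segment go to `(l, -n mod n!)` and `(r, n mod n!)`. -/
def Spiral.xiM {n : ℕ} : Spiral (n + 1) → Spiral n
  | .l k => .l (residue n k)
  | .m k =>
      if h : (k : ℤ) ∈ Set.Ioo (-(n : ℤ)) (n : ℤ) then .m ⟨k, h⟩
      else if (k : ℤ) ≤ -(n : ℤ) then .l ((k : ℤ) : ZMod n.factorial)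
      else .r ((k : ℤ) : ZMod n.factorial)
  | .r k => .r (residue n k)

/-- The six letters `ξ_{L_1}, ξ_{L_2}, ξ_{M_1}, ξ_{M_2}, ξ_{G_1}, ξ_{G_2}`. -/
inductive Letter : Type
  | L₁ | L₂ | M₁ | M₂ | G₁ | G₂

/-- The map of spirals named by a letter. -/
def Letter.map {n : ℕ} : Letter → Spiral (n + 1) → Spiral n
  | .L₁ => Spiral.xiL
  | .L₂ => Spiral.xiL
  | .M₁ => Spiral.xiM
  | .M₂ => Spiral.xiM
  | .G₁ => Spiral.xiG
  | .G₂ => Spiral.xiG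

/-- `W_n`: the disjoint union of `6 ^ n` copies of the `n`-spiral, indexed by the words of length
`n` in the six letters. -/
def W (n : ℕ) : Type := (Fin n → Letter) × Spiral n

/-- `W_n` is a discrete space. -/
instance (n : ℕ) : TopologicalSpace (W n) := ⊥

/-- The relation `R_n` on `W_n`: the union of the relations of the spirals. -/
def R (n : ℕ) (x y : W n) : Prop := x.1 = y.1 ∧ Spiral.Rel n x.2 y.2

/-- One step of the canonical map: the last letter of the word is removed, and the map of spirals
that it names is applied. -/
def xiStep (n : ℕ) (x : W (n + 1)) : W n :=
  (Fin.init x.1, (x.1 (Fin.last n)).map x.2)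

/-- The canonical map `ξ : W_{n+k} → W_n`. -/
def xi (n : ℕ) : (k : ℕ) → W (n + k) → W n
  | 0 => id
  | k + 1 => fun x => xi n k (xiStep (n + k) x)

/-! ### The lifting property -/

section Systems

variable {X : Type*}

/-- `φ : (X, σ) → (W_n, R_n)`: a continuous surjection with `φ(x) R_n φ(σ(x))` for all `x`. -/
def IsFactorMap [TopologicalSpace X] (σ : X ≃ₜ X) (n : ℕ) (φ : X → W n) : Prop :=
  Continuous φ ∧ Function.Surjective φ ∧ ∀ x, R n (φ x) (φ (σ x))

/-- The partition `A_φ` of `X` into the fibres of `φ`. -/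
def fibres {Y : Type*} (φ : X → Y) : Set (Set X) := Set.range fun y => φ ⁻¹' {y}

/-- A partition of `X` into nonempty clopen sets. -/
def IsClopenPartition [TopologicalSpace X] (A : Set (Set X)) : Prop :=
  Setoid.IsPartition A ∧ ∀ V ∈ A, IsClopen V

/-- `A` refines `B`: every cell of `A` lies in a cell of `B`. -/
def Refines (A B : Set (Set X)) : Prop := ∀ V ∈ A, ∃ V' ∈ B, V ⊆ V'

/-- The lifting property of a homeomorphism of a metric space (meant for Cantor sets): there is a
factor map onto some `(W_n, R_n)`, and every such factor map lifts through `ξ` to factor maps whose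
fibres have arbitrarily small diameter. -/
def LiftingProperty [MetricSpace X] (σ : X ≃ₜ X) : Prop :=
  (∃ n : ℕ, 1 ≤ n ∧ ∃ φ : X → W n, IsFactorMap σ n φ) ∧
  ∀ ε : ℝ, 0 < ε → ∀ n : ℕ, 1 ≤ n → ∀ φ : X → W n, IsFactorMap σ n φ →
    ∃ k : ℕ, 1 ≤ k ∧ ∃ ψ : X → W (n + k), IsFactorMap σ (n + k) ψ ∧
      (∀ V ∈ fibres ψ, Metric.diam V < ε) ∧ φ = xi n k ∘ ψ

/-- The lifting property in purely topological terms, for compact zero-dimensional spaces that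
need not be metrizable: smallness of the fibres is replaced by refinement of a given clopen
partition. -/
def TopLiftingProperty [TopologicalSpace X] (σ : X ≃ₜ X) : Prop :=
  (∃ n : ℕ, 1 ≤ n ∧ ∃ φ : X → W n, IsFactorMap σ n φ) ∧
  ∀ n : ℕ, 1 ≤ n → ∀ φ : X → W n, IsFactorMap σ n φ →
    ∀ A : Set (Set X), IsClopenPartition A → Refines A (fibres φ) →
      ∃ k : ℕ, 1 ≤ k ∧ ∃ ψ : X → W (n + k), IsFactorMap σ (n + k) ψ ∧
        Refines (fibres ψ) A ∧ φ = xi n k ∘ ψ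

end Systems

/-! ### Ultrapowers of commutative C⋆-algebras -/

section Ultrapower

variable {A : Type*} [CommCStarAlgebra A] (U : Ultrafilter ℕ)

/-- The ideal of the bounded sequences `a` in `A` with `lim_{n → U} ‖a n‖ = 0`. -/
def nullIdeal (A : Type*) [CommCStarAlgebra A] (U : Ultrafilter ℕ) : Ideal (ℕ →ᵇ A) where
  carrier := {a | Tendsto (fun n => ‖a n‖) U (𝓝 0)}
  zero_mem' := by simp
  add_mem' := by
    intro a b ha hb
    refine squeeze_zero (fun n => norm_nonneg _) (fun n => ?_) (by simpa using ha.add hb)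
    exact norm_add_le (a n) (b n)
  smul_mem' := by
    intro c a ha
    refine squeeze_zero (fun n => norm_nonneg _) (fun n => ?_) (by simpa using ha.const_mul ‖c‖)
    exact (norm_mul_le (c n) (a n)).trans
      (mul_le_mul_of_nonneg_right (c.norm_coe_le_norm n) (norm_nonneg _))

theorem mem_nullIdeal {a : ℕ →ᵇ A} :
    a ∈ nullIdeal A U ↔ Tendsto (fun n => ‖a n‖) U (𝓝 0) := Iff.rfl

/-- The ultrapower `A^U`: bounded sequences modulo those that tend to `0` along `U`. -/
abbrev Ultrapower (A : Type*) [CommCStarAlgebra A] (U : Ultrafilter ℕ) : Type _ :=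
  (ℕ →ᵇ A) ⧸ nullIdeal A U

theorem exists_tendsto_norm (a : ℕ →ᵇ A) :
    ∃ L : ℝ, Tendsto (fun n => ‖a n‖) U (𝓝 L) := by
  obtain ⟨L, -, hL⟩ := (isCompact_Icc (a := (0 : ℝ)) (b := ‖a‖)).ultrafilter_le_nhds
    (U.map fun n => ‖a n‖) (by
      rw [le_principal_iff]
      have h : ∀ᶠ n in (U : Filter ℕ), ‖a n‖ ∈ Set.Icc 0 ‖a‖ :=
        Filter.Eventually.of_forall fun n => ⟨norm_nonneg _, a.norm_coe_le_norm n⟩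
      exact h)
  exact ⟨L, hL⟩

/-- The norm of the ultrapower is the limit of the norms along `U`. -/
theorem tendsto_norm_mk (a : ℕ →ᵇ A) :
    Tendsto (fun n => ‖a n‖) U (𝓝 ‖Ideal.Quotient.mk (nullIdeal A U) a‖) := by
  obtain ⟨L, hL⟩ := exists_tendsto_norm U a
  suffices h : ‖Ideal.Quotient.mk (nullIdeal A U) a‖ = L by rwa [h]
  apply le_antisymm
  · refine le_of_forall_pos_le_add fun ε hε => ?_
    have hL0 : 0 ≤ L := ge_of_tendsto' hL fun n => norm_nonneg _
    have hs : ∀ᶠ n in (U : Filter ℕ), ‖a n‖ < L + ε := hL.eventually_lt_const (by linarith)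
    classical
    let b : ℕ →ᵇ A := BoundedContinuousFunction.ofNormedAddCommGroup
      (fun n => if ‖a n‖ < L + ε then a n else 0) continuous_of_discreteTopology (L + ε)
      (fun n => by
        split_ifs with h
        · exact h.le
        · rw [norm_zero]; positivity)
    have hb : Ideal.Quotient.mk (nullIdeal A U) a = Ideal.Quotient.mk (nullIdeal A U) b := by
      rw [Ideal.Quotient.eq, mem_nullIdeal]
      refine tendsto_const_nhds.congr' ?_
      filter_upwards [hs] with n hn
      simp [b, hn]
    rw [hb]
    refine (Ideal.Quotient.norm_mk_le _ b).trans ?_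
    exact BoundedContinuousFunction.norm_ofNormedAddCommGroup_le _ (by positivity) _
  · refine le_of_forall_pos_le_add fun ε hε => ?_
    obtain ⟨b, hb, hbn⟩ := Ideal.Quotient.norm_mk_lt (Ideal.Quotient.mk (nullIdeal A U) a) hε
    have hab : Tendsto (fun n => ‖(a - b) n‖) U (𝓝 0) := by
      rw [← mem_nullIdeal, ← Ideal.Quotient.eq, hb]
    refine le_of_tendsto_of_tendsto' hL
      (f := fun n => ‖a n‖) (g := fun n => ‖(a - b) n‖ + ‖b‖) (by simpa using hab.add_const ‖b‖)
      (fun n => ?_) |>.trans hbn.le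
    calc ‖a n‖ = ‖(a - b) n + b n‖ := by simp
      _ ≤ ‖(a - b) n‖ + ‖b n‖ := norm_add_le _ _
      _ ≤ ‖(a - b) n‖ + ‖b‖ := by gcongr; exact b.norm_coe_le_norm n

instance : IsClosed (nullIdeal A U : Set (ℕ →ᵇ A)) := by
  rw [← closure_subset_iff_isClosed]
  intro a ha
  have h0 : ‖Ideal.Quotient.mk (nullIdeal A U) a‖ = 0 :=
    (QuotientAddGroup.norm_mk_eq_zero_iff_mem_closure
      (S := (nullIdeal A U).toAddSubgroup) (m := a)).2 ha
  have h := tendsto_norm_mk U a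
  rwa [h0] at h

theorem star_mem_nullIdeal {a : ℕ →ᵇ A} (ha : a ∈ nullIdeal A U) : star a ∈ nullIdeal A U := by
  rw [mem_nullIdeal] at ha ⊢
  simpa using ha

/-- The involution of the ultrapower is `[a n] ↦ [star (a n)]`. -/
instance : Star (Ultrapower A U) where
  star := Quotient.map' star fun a b h => by
    rw [Submodule.quotientRel_def] at h ⊢
    rw [← star_sub]
    exact star_mem_nullIdeal U h

theorem star_mk (a : ℕ →ᵇ A) :
    star (Ideal.Quotient.mk (nullIdeal A U) a) = Ideal.Quotient.mk (nullIdeal A U) (star a) := rfl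

instance : StarRing (Ultrapower A U) where
  star_involutive x := by
    obtain ⟨a, rfl⟩ := Ideal.Quotient.mk_surjective x
    rw [star_mk, star_mk, star_star]
  star_mul x y := by
    obtain ⟨a, rfl⟩ := Ideal.Quotient.mk_surjective x
    obtain ⟨b, rfl⟩ := Ideal.Quotient.mk_surjective y
    rw [← map_mul, star_mk, star_mk, star_mk, star_mul, map_mul]
  star_add x y := by
    obtain ⟨a, rfl⟩ := Ideal.Quotient.mk_surjective x
    obtain ⟨b, rfl⟩ := Ideal.Quotient.mk_surjective y
    rw [← map_add, star_mk, star_mk, star_mk, star_add, map_add]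

/-- The ultrapower is a commutative unital C⋆-algebra. -/
instance : CommCStarAlgebra (Ultrapower A U) where
  norm_mul_self_le x := by
    obtain ⟨a, rfl⟩ := Ideal.Quotient.mk_surjective x
    have h1 := tendsto_norm_mk U a
    have h2 := tendsto_norm_mk U (star a * a)
    rw [star_mk, ← map_mul]
    refine (tendsto_nhds_unique (h1.mul h1) (h2.congr fun n => ?_)).le
    simpa using CStarRing.norm_star_mul_self (x := a n)
  star_smul c x := by
    obtain ⟨a, rfl⟩ := Ideal.Quotient.mk_surjective x
    change Ideal.Quotient.mk (nullIdeal A U) (star (c • a)) =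
      Ideal.Quotient.mk (nullIdeal A U) (star c • star a)
    rw [star_smul]

/-- A star-algebra automorphism of `A` acts termwise on bounded sequences. -/
def mapSeq (α : A ≃⋆ₐ[ℂ] A) : (ℕ →ᵇ A) →+* (ℕ →ᵇ A) where
  toFun a := BoundedContinuousFunction.ofNormedAddCommGroup (fun n => α (a n))
    continuous_of_discreteTopology ‖a‖
    (fun n => (StarAlgEquiv.norm_map α (a n)).le.trans (a.norm_coe_le_norm n))
  map_one' := by ext n; simp
  map_zero' := by ext n; simp
  map_mul' a b := by ext n; simp
  map_add' a b := by ext n; simp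

theorem mapSeq_mem (α : A ≃⋆ₐ[ℂ] A) :
    nullIdeal A U ≤ (nullIdeal A U).comap (mapSeq α) := by
  intro a ha
  rw [Ideal.mem_comap, mem_nullIdeal]
  rw [mem_nullIdeal] at ha
  exact ha.congr fun n => (StarAlgEquiv.norm_map α (a n)).symm

/-- The automorphism `[a n] ↦ [α (a n)]` of the ultrapower. -/
def ultrapowerAut (α : A ≃⋆ₐ[ℂ] A) : Ultrapower A U ≃⋆ₐ[ℂ] Ultrapower A U where
  toFun := Ideal.quotientMap (nullIdeal A U) (mapSeq α) (mapSeq_mem U α)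
  invFun := Ideal.quotientMap (nullIdeal A U) (mapSeq α.symm) (mapSeq_mem U α.symm)
  left_inv x := by
    obtain ⟨a, rfl⟩ := Ideal.Quotient.mk_surjective x
    rw [Ideal.quotientMap_mk, Ideal.quotientMap_mk]
    congr 1
    ext n
    exact α.symm_apply_apply (a n)
  right_inv x := by
    obtain ⟨a, rfl⟩ := Ideal.Quotient.mk_surjective x
    rw [Ideal.quotientMap_mk, Ideal.quotientMap_mk]
    congr 1
    ext n
    exact α.apply_symm_apply (a n)
  map_mul' := map_mul _
  map_add' := map_add _
  map_star' x := by
    obtain ⟨a, rfl⟩ := Ideal.Quotient.mk_surjective x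
    rw [star_mk, Ideal.quotientMap_mk, Ideal.quotientMap_mk, star_mk]
    congr 1
    ext n
    exact map_star α (a n)
  map_smul' c x := by
    obtain ⟨a, rfl⟩ := Ideal.Quotient.mk_surjective x
    change Ideal.Quotient.mk (nullIdeal A U) (mapSeq α (c • a)) =
      Ideal.Quotient.mk (nullIdeal A U) (c • mapSeq α a)
    congr 1
    ext n
    exact map_smul α c (a n)

end Ultrapower

/-! ### Gelfand duality for systems -/

section Duality

/-- The automorphism `f ↦ f ∘ σ` of `C(X)` induced by a homeomorphism `σ` of `X`. -/
def inducedAut {X : Type*} [TopologicalSpace X] [CompactSpace X] (σ : X ≃ₜ X) :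
    C(X, ℂ) ≃⋆ₐ[ℂ] C(X, ℂ) :=
  σ.compStarAlgEquiv' ℂ ℂ

/-- The pair `(A, α)` corresponds to the dynamical system `(Y, τ)`: it is isomorphic to
`C(Y)` with the automorphism induced by `τ`. -/
def CorrespondsTo {A : Type*} [CommCStarAlgebra A] (α : A ≃⋆ₐ[ℂ] A)
    {Y : Type*} [TopologicalSpace Y] [CompactSpace Y] (τ : Y ≃ₜ Y) : Prop :=
  ∃ e : A ≃⋆ₐ[ℂ] C(Y, ℂ), ∀ a, e (α a) = inducedAut τ (e a)

end Duality

/-! ### Continuous logic for C⋆-algebras with an automorphism -/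

section Logic

/-- Terms in `n` variables of the language of unital C⋆-algebras with a symbol `σ` for an
automorphism. -/
inductive Term (n : ℕ) : Type
  | var (i : Fin n) : Term n
  | zero : Term n
  | one : Term n
  | add (s t : Term n) : Term n
  | mul (s t : Term n) : Term n
  | smul (c : ℂ) (t : Term n) : Term n
  | star (t : Term n) : Term n
  | sigma (t : Term n) : Term n

/-- Formulas in `n` free variables: norms of terms, continuous real-valued connectives in finitely
many arguments, and the quantifiers `sup` and `inf` over the closed balls of integer radius (these
balls are the sorts of the structure). -/
inductive Formula : ℕ → Type
  | norm {n : ℕ} (t : Term n) : Formula n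
  | connective {n j : ℕ} (f : C(Fin j → ℝ, ℝ)) (φ : Fin j → Formula n) : Formula n
  | sup {n : ℕ} (N : ℕ) (φ : Formula (n + 1)) : Formula n
  | inf {n : ℕ} (N : ℕ) (φ : Formula (n + 1)) : Formula n

/-- A sentence is a formula without free variables. -/
abbrev Sentence : Type := Formula 0

variable {A : Type*} [CommCStarAlgebra A] (α : A ≃⋆ₐ[ℂ] A)

/-- The interpretation of a term in `(A, α)`. -/
def Term.eval {n : ℕ} (v : Fin n → A) : Term n → A
  | .var i => v i
  | .zero => 0
  | .one => 1
  | .add s t => s.eval v + t.eval v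
  | .mul s t => s.eval v * t.eval v
  | .smul c t => c • t.eval v
  | .star t => Star.star (t.eval v)
  | .sigma t => α (t.eval v)

/-- The interpretation of a formula in `(A, α)`. -/
def Formula.eval : {n : ℕ} → Formula n → (Fin n → A) → ℝ
  | _, .norm t, v => ‖t.eval α v‖
  | _, .connective f φ, v => f fun i => (φ i).eval v
  | _, .sup N φ, v => ⨆ a : Metric.closedBall (0 : A) N, φ.eval (Fin.snoc v (a : A))
  | _, .inf N φ, v => ⨅ a : Metric.closedBall (0 : A) N, φ.eval (Fin.snoc v (a : A))

/-- `(A, α)` is a model of the theory `T`: every sentence of `T` takes the value `0`. -/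
def Models (T : Set Sentence) : Prop := ∀ φ ∈ T, φ.eval α Fin.elim0 = 0

end Logic

/-- A property of dynamical systems is axiomatizable over the theory of the pairs `(C(X), σ)` with
`X` a compact zero-dimensional Hausdorff space without isolated points and `σ` an automorphism:
there is a theory `T` such that such a pair is a model of `T` if and only if the system `(X, σ)` has
the property. -/
def IsAxiomatizableOverCantorA
    (P : ∀ (X : Type u) [TopologicalSpace X], (X ≃ₜ X) → Prop) : Prop :=
  ∃ T : Set Sentence, ∀ (X : Type u) [TopologicalSpace X] [CompactSpace X] [T2Space X]
    [TotallyDisconnectedSpace X] [PerfectSpace X] [Nonempty X] (σ : X ≃ₜ X),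
    Models (inducedAut σ) T ↔ P X σ

end CantorDynamics

end

/-! The lifting property bounds the complexity of orbits. A clopen set `D` and a factor map onto
some `W_n` generate a clopen partition, so a lift to some `W_{n+k}` decides membership in `D`.
Orbits become walks in a finite spiral, which end up in a cycle, so every itinerary with respect to
`D` is eventually periodic (`TopLiftingProperty.eventually_periodic`).

This periodicity has no bound uniform in `D`, and an ultrapower exploits that. A factor map onto
some `W_n` yields a point `x` with infinite forward orbit, and zero-dimensionality yields for each
`i` a clopen `D i` that contains `σ^[j] x`, for `j ≤ i`, exactly when `j` is a square. The
indicators of the `D i` define a projection of the ultrapower, hence a clopen subset of `Y`;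
evaluation at `x` along `U` is a character, hence a point of `Y`. The itinerary of that point is the
set of all squares, which is not eventually periodic (`not_topLiftingProperty_of_correspondsTo`).

By Łoś's theorem (`Formula.tendsto_eval`) the ultrapower satisfies every theory that the original
pair satisfies, and its space is again zero-dimensional and perfect. The corollary therefore only
needs one system with the lifting property: the inverse limit of the `W_n`. A factor map of it onto
`W_n` is `f` applied to a coordinate, for some morphism `f : W_m → W_n`. The key `exists_comp_eq_xi`
completes `f` to `f ∘ h = ξ`; completing `h` in turn to `h ∘ q = ξ` produces the lift `q ∘ coord`.
The key lemma views spirals as quotients of the line of integers: up to a shift there are only three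
bi-infinite walks, so a morphism acts on each spiral through a kind and a shift, and the doubled
letters supply enough words to reach every spiral of the domain of `f`. -/

namespace CantorDynamics

noncomputable section

/-! ### Spirals as quotients of the line -/

/-- The point of the `n`-spiral reached by following the line of integers: it winds around the left
cycle up to `-n`, crosses the middle segment, and winds around the right cycle from `n` on. -/
def place (n : ℕ) (j : ℤ) : Spiral n :=
  if h : j ∈ Set.Ioo (-(n : ℤ)) (n : ℤ) then .m ⟨j, h⟩
  else if j ≤ -(n : ℤ) then .l (j : ZMod n.factorial)
  else .r (j : ZMod n.factorial)

theorem place_mid {n : ℕ} {j : ℤ} (h : j ∈ Set.Ioo (-(n : ℤ)) (n : ℤ)) :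
    place n j = .m ⟨j, h⟩ := dif_pos h

theorem place_left {n : ℕ} {j : ℤ} (h : j ≤ -(n : ℤ)) : place n j = .l (j : ZMod n.factorial) := by
  rw [place, dif_neg (fun h' => absurd h'.1 (not_lt.2 h)), if_pos h]

theorem place_right {n : ℕ} {j : ℤ} (h : (n : ℤ) ≤ j) (h' : -(n : ℤ) < j) :
    place n j = .r (j : ZMod n.factorial) := by
  rw [place, dif_neg (fun h' => absurd h'.2 (not_lt.2 h)), if_neg (not_le.2 h')]

theorem exists_sub_mul_le {N : ℕ} (hN : 0 < N) (j b : ℤ) : ∃ t : ℕ, j - t * N ≤ b := by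
  refine ⟨(j - b).toNat, ?_⟩
  have h1 : j - b ≤ ((j - b).toNat : ℤ) := Int.self_le_toNat _
  have h2 : (0 : ℤ) ≤ ((j - b).toNat : ℤ) := Int.natCast_nonneg _
  have h3 : (1 : ℤ) ≤ N := by exact_mod_cast hN
  nlinarith

theorem exists_le_add_mul {N : ℕ} (hN : 0 < N) (j b : ℤ) : ∃ t : ℕ, b ≤ j + t * N := by
  obtain ⟨t, ht⟩ := exists_sub_mul_le hN (-j) (-b)
  exact ⟨t, by linarith⟩

theorem intCast_sub_mul {N M : ℕ} (h : M ∣ N) (j : ℤ) (t : ℕ) :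
    ((j - t * N : ℤ) : ZMod M) = (j : ZMod M) := by
  have : ((N : ℕ) : ZMod M) = 0 := (ZMod.natCast_eq_zero_iff N M).2 h
  push_cast
  rw [this]; simp

theorem intCast_add_mul {N M : ℕ} (h : M ∣ N) (j : ℤ) (t : ℕ) :
    ((j + t * N : ℤ) : ZMod M) = (j : ZMod M) := by
  have : ((N : ℕ) : ZMod M) = 0 := (ZMod.natCast_eq_zero_iff N M).2 h
  push_cast
  rw [this]; simp

theorem intCast_eq_of_dvd {N M : ℕ} (h : M ∣ N) {i j : ℤ} (e : (i : ZMod N) = (j : ZMod N)) :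
    (i : ZMod M) = (j : ZMod M) := by
  rw [ZMod.intCast_eq_intCast_iff_dvd_sub] at e ⊢
  exact (Int.natCast_dvd_natCast.2 h).trans e

theorem intCast_add_eq {N : ℕ} {i j : ℤ} (c : ℤ) (e : (i : ZMod N) = (j : ZMod N)) :
    ((i + c : ℤ) : ZMod N) = ((j + c : ℤ) : ZMod N) := by
  push_cast; rw [e]

/-- Subtracting multiples of `n!` goes below any bound `b`. The freedom in `b` moves cycle points so
far out on the line that shifted walks are already periodic there. -/
theorem left_eq_place {n : ℕ} (i b : ℤ) :
    ∃ j, j ≤ b ∧ j ≤ -(n : ℤ) ∧ (j : ZMod n.factorial) = i ∧ place n j = .l i := by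
  obtain ⟨t, ht⟩ := exists_sub_mul_le n.factorial_pos i (min b (-(n : ℤ)))
  refine ⟨_, ht.trans (min_le_left _ _), ht.trans (min_le_right _ _),
    intCast_sub_mul dvd_rfl i t, ?_⟩
  rw [place_left (ht.trans (min_le_right _ _)), intCast_sub_mul dvd_rfl]

theorem right_eq_place {n : ℕ} (hn : 1 ≤ n) (i b : ℤ) :
    ∃ j, b ≤ j ∧ (n : ℤ) ≤ j ∧ (j : ZMod n.factorial) = i ∧ place n j = .r i := by
  obtain ⟨t, ht⟩ := exists_le_add_mul n.factorial_pos i (max b (n : ℤ))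
  have h2 := (le_max_right _ _).trans ht
  refine ⟨_, (le_max_left _ _).trans ht, h2, intCast_add_mul dvd_rfl i t, ?_⟩
  rw [place_right h2 (by omega), intCast_add_mul dvd_rfl]

theorem place_surjective {n : ℕ} (hn : 1 ≤ n) : Function.Surjective (place n) := by
  rintro (k | k | k)
  · obtain ⟨i, rfl⟩ := ZMod.intCast_surjective k
    obtain ⟨j, -, -, -, h⟩ := left_eq_place (n := n) i 0
    exact ⟨j, h⟩
  · exact ⟨k, place_mid k.2⟩
  · obtain ⟨i, rfl⟩ := ZMod.intCast_surjective k
    obtain ⟨j, -, -, -, h⟩ := right_eq_place hn i 0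
    exact ⟨j, h⟩

theorem place_eq_cases {n : ℕ} {i j : ℤ} (h : place n i = place n j) :
    i = j ∨ (i ≤ -(n : ℤ) ∧ j ≤ -(n : ℤ) ∧ (i : ZMod n.factorial) = j) ∨
      ((n : ℤ) ≤ i ∧ (n : ℤ) ≤ j ∧ -(n : ℤ) < i ∧ -(n : ℤ) < j ∧ (i : ZMod n.factorial) = j) := by
  unfold place at h
  split_ifs at h with h1 h2 h3 h4 h5 h6 h7 <;> simp at h
  · exact .inl h
  · exact .inr (.inl ⟨by assumption, by assumption, h⟩)
  · simp only [Set.mem_Ioo, not_and, not_lt, not_le] at *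
    refine .inr (.inr ⟨?_, ?_, ?_, ?_, h⟩) <;> omega

theorem rel_place {n : ℕ} (hn : 1 ≤ n) (j : ℤ) : Spiral.Rel n (place n j) (place n (j + 1)) := by
  rcases lt_trichotomy (j + 1) (-(n : ℤ) + 1) with h | h | h
  · rw [place_left (by omega), place_left (by omega)]
    push_cast
    exact .left _
  · obtain rfl : j = -(n : ℤ) := by omega
    rw [place_left le_rfl, place_mid (by constructor <;> omega)]
    push_cast
    exact .enter _ rfl
  · rcases lt_trichotomy (j + 1) (n : ℤ) with h' | h' | h'
    · rw [place_mid (by constructor <;> omega), place_mid (by constructor <;> omega)]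
      exact .middle _ _ rfl
    · rw [place_mid (by constructor <;> omega), place_right (by omega) (by omega), h']
      push_cast
      exact .exit _ (by simp; omega)
    · rw [place_right (by omega) (by omega), place_right (by omega) (by omega)]
      push_cast
      exact .right _

/-- The spiral is a quotient of the line, with relation the image of the successor relation;
questions about `Spiral.Rel` become integer arithmetic. -/
theorem rel_iff {n : ℕ} (hn : 1 ≤ n) {x y : Spiral n} :
    Spiral.Rel n x y ↔ ∃ j, x = place n j ∧ y = place n (j + 1) := by
  constructor
  · rintro (k | k | ⟨k, k', h⟩ | ⟨k, h⟩ | ⟨k, h⟩)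
    · obtain ⟨i, rfl⟩ := ZMod.intCast_surjective k
      -- One unit to spare: `j + 1` must still lie in the left cycle.
      obtain ⟨j, h1, -, h2, h⟩ := left_eq_place (n := n) i (-(n : ℤ) - 1)
      refine ⟨j, h.symm, ?_⟩
      rw [place_left (by omega), ← h2]; push_cast; rfl
    · obtain ⟨i, rfl⟩ := ZMod.intCast_surjective k
      obtain ⟨j, -, h1, h2, h⟩ := right_eq_place hn i 0
      refine ⟨j, h.symm, ?_⟩
      rw [place_right (by omega) (by omega), ← h2]; push_cast; rfl
    · refine ⟨k, (place_mid k.2).symm, ?_⟩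
      rw [← h]
      exact (place_mid k'.2).symm
    · refine ⟨-(n : ℤ), ?_, ?_⟩
      · rw [place_left le_rfl]; push_cast; rfl
      · rw [← h]
        exact (place_mid k.2).symm
    · refine ⟨k, (place_mid k.2).symm, ?_⟩
      rw [h, place_right (by omega) (by omega)]; simp
  · rintro ⟨j, rfl, rfl⟩
    exact rel_place hn j

/-! ### Walks in a spiral -/

/-- The three ways in which a bi-infinite walk may run through a spiral: it stays in the left cycle,
it crosses the middle segment, or it stays in the right cycle. -/
inductive Kind : Type
  | left | mid | right

/-- The standard walk of the given kind. -/
def Kind.path (n : ℕ) : Kind → ℤ → Spiral n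
  | .left, j => .l (j : ZMod n.factorial)
  | .mid, j => place n j
  | .right, j => .r (j : ZMod n.factorial)

/-- Composition of kinds: all but `mid` absorb what comes after. -/
def Kind.comp : Kind → Kind → Kind
  | .mid, K => K
  | .left, _ => .left
  | .right, _ => .right

/-- The kind of walk to which the map named by a letter sends the standard crossing walk. -/
def Letter.kind : Letter → Kind
  | .L₁ => .left
  | .L₂ => .left
  | .M₁ => .mid
  | .M₂ => .mid
  | .G₁ => .right
  | .G₂ => .right

theorem Kind.comp_assoc (K L M : Kind) : (K.comp L).comp M = K.comp (L.comp M) := by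
  cases K <;> rfl

theorem Kind.comp_mid (K : Kind) : K.comp .mid = K := by cases K <;> rfl

theorem residue_intCast (n : ℕ) (j : ℤ) :
    residue n (j : ZMod (n + 1).factorial) = (j : ZMod n.factorial) := map_intCast _ _

theorem position_place (n : ℕ) (j : ℤ) : (place (n + 1) j).position = (j : ZMod n.factorial) := by
  unfold place
  split_ifs
  · rfl
  · exact residue_intCast n j
  · exact residue_intCast n j

theorem xiM_place (n : ℕ) (j : ℤ) : (place (n + 1) j).xiM = place n j := by
  by_cases h1 : j ≤ -((n + 1 : ℕ) : ℤ)
  · rw [place_left h1, place_left (by push_cast at h1; omega)]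
    simp only [Spiral.xiM, residue_intCast]
  · by_cases h2 : ((n + 1 : ℕ) : ℤ) ≤ j
    · rw [place_right h2 (by omega), place_right (by push_cast at h2; omega)
        (by push_cast at h2; omega)]
      simp only [Spiral.xiM, residue_intCast]
    · rw [place_mid (by constructor <;> omega)]
      rfl

/-- `ξ_L` and `ξ_G` retain only the position and `ξ_M` respects the coordinate on the line, so
letters act on standard walks by composition of kinds, without a shift. -/
theorem Letter.map_path (a : Letter) (K : Kind) (n : ℕ) (j : ℤ) :
    a.map (K.path (n + 1) j) = (a.kind.comp K).path n j := by
  cases K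
  · cases a <;> simp [Letter.map, Letter.kind, Kind.comp, Kind.path, Spiral.xiL, Spiral.xiG,
      Spiral.position, Spiral.xiM]
  · cases a <;> simp only [Letter.map, Letter.kind, Kind.comp, Kind.path, Spiral.xiL, Spiral.xiG,
      position_place, xiM_place]
  · cases a <;> simp [Letter.map, Letter.kind, Kind.comp, Kind.path, Spiral.xiL, Spiral.xiG,
      Spiral.position, Spiral.xiM]

theorem path_rel {n : ℕ} (hn : 1 ≤ n) (K : Kind) (j : ℤ) :
    Spiral.Rel n (K.path n j) (K.path n (j + 1)) := by
  cases K
  · simp only [Kind.path]; push_cast; exact .left _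
  · exact rel_place hn j
  · simp only [Kind.path]; push_cast; exact .right _

theorem rel_forward_left {n : ℕ} {k : ZMod n.factorial} {y : Spiral n}
    (h : Spiral.Rel n (.l k) y) : y = .l (k + 1) ∨ ∃ k', y = .m k' := by
  cases h
  · exact .inl rfl
  · exact .inr ⟨_, rfl⟩

theorem rel_forward_right {n : ℕ} {k : ZMod n.factorial} {y : Spiral n}
    (h : Spiral.Rel n (.r k) y) : y = .r (k + 1) := by
  cases h; rfl

theorem rel_backward_left {n : ℕ} {k : ZMod n.factorial} {y : Spiral n}
    (h : Spiral.Rel n y (.l k)) : y = .l (k - 1) := by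
  cases h; simp

theorem rel_backward_right {n : ℕ} {k : ZMod n.factorial} {y : Spiral n}
    (h : Spiral.Rel n y (.r k)) : y = .r (k - 1) ∨ ∃ k', y = .m k' := by
  cases h
  · left; simp
  · exact .inr ⟨_, rfl⟩

/-- Successors branch only on the left cycle, where the segment is entered; dually, predecessors
branch only on the right cycle. -/
theorem rel_forward_place {n : ℕ} (hn : 1 ≤ n) {j : ℤ} (hj : -(n : ℤ) < j) {y : Spiral n}
    (h : Spiral.Rel n (place n j) y) : y = place n (j + 1) := by
  obtain ⟨i, h1, rfl⟩ := (rel_iff hn).1 h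
  rcases place_eq_cases h1 with rfl | h | h
  · rfl
  · omega
  · rw [place_right (by omega) (by omega), place_right (by omega) (by omega)]
    congr 1; exact intCast_add_eq 1 h.2.2.2.2.symm

theorem rel_backward_place {n : ℕ} (hn : 1 ≤ n) {j : ℤ} (hj : j < (n : ℤ)) {y : Spiral n}
    (h : Spiral.Rel n y (place n j)) : y = place n (j - 1) := by
  obtain ⟨i, rfl, h1⟩ := (rel_iff hn).1 h
  rcases place_eq_cases h1 with rfl | h | h
  · simp
  · rw [place_left (by omega), place_left (by omega)]
    congr 1
    have := intCast_add_eq (-1) h.2.2.symm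
    simpa [sub_eq_add_neg] using this
  · omega

/-- Every bi-infinite walk in a spiral is a shift of a standard walk. -/
theorem exists_path_eq {n : ℕ} (hn : 1 ≤ n) (γ : ℤ → Spiral n)
    (hγ : ∀ j, Spiral.Rel n (γ j) (γ (j + 1))) :
    ∃ (K : Kind) (s : ℤ), ∀ j, γ j = K.path n (j - s) := by
  -- A walk that meets the middle segment is determined from there in both directions. A walk that
  -- avoids it cannot leave its cycle.
  by_cases hm : ∃ a k, γ a = .m k
  · obtain ⟨a, k, hk⟩ := hm
    rw [← place_mid k.2] at hk
    refine ⟨.mid, a - k, fun j => ?_⟩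
    have hk1 := k.2.1
    have hk2 := k.2.2
    have key : γ (a + (j - a)) = place n (k + (j - a)) := by
      induction j - a using Int.induction_on with
      | zero => simpa using hk
      | succ i ih =>
        have := hγ (a + i)
        rw [ih] at this
        have := rel_forward_place hn (by omega) this
        rw [← add_assoc, this, ← add_assoc]
      | pred i ih =>
        have := hγ (a + (-i - 1))
        rw [show a + (-(i : ℤ) - 1) + 1 = a + -i by ring, ih] at this
        have := rel_backward_place hn (by omega) this
        rw [this]; congr 1; ring
    have e1 : a + (j - a) = j := by ring
    rw [e1] at key
    rw [key, Kind.path]; congr 1; ring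
  · have hm' : ∀ a k, γ a ≠ .m k := fun a k h => hm ⟨a, k, h⟩
    rcases h0 : γ 0 with k | k | k
    · obtain ⟨i, rfl⟩ := ZMod.intCast_surjective k
      refine ⟨.left, -i, fun j => ?_⟩
      rw [Kind.path, sub_neg_eq_add]
      induction j using Int.induction_on with
      | zero => simpa using h0
      | succ j ih =>
        have := hγ j
        rw [ih] at this
        rcases rel_forward_left this with h | ⟨k', h⟩
        · rw [h]; congr 1; push_cast; ring
        · exact absurd h (hm' _ _)
      | pred j ih =>
        have := hγ (-j - 1)
        rw [sub_add_cancel, ih] at this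
        rw [rel_backward_left this]; congr 1; push_cast; ring
    · exact absurd h0 (hm' _ _)
    · obtain ⟨i, rfl⟩ := ZMod.intCast_surjective k
      refine ⟨.right, -i, fun j => ?_⟩
      rw [Kind.path, sub_neg_eq_add]
      induction j using Int.induction_on with
      | zero => simpa using h0
      | succ j ih =>
        have := hγ j
        rw [ih] at this
        rw [rel_forward_right this]; congr 1; push_cast; ring
      | pred j ih =>
        have := hγ (-j - 1)
        rw [sub_add_cancel, ih] at this
        rcases rel_backward_right this with h | ⟨k', h⟩
        · rw [h]; congr 1; push_cast; ring
        · exact absurd h (hm' _ _)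

/-! ### The canonical maps on walks -/

/-- The word to which `ξ` truncates a word, and the kind of walk to which it sends the standard
crossing walk of the spiral of that word. -/
def classOf (n : ℕ) : (k : ℕ) → (Fin (n + k) → Letter) → (Fin n → Letter) × Kind
  | 0, u => (u, .mid)
  | k + 1, u =>
    let c := classOf n k (Fin.init (n := n + k) (α := fun _ => Letter) u)
    (c.1, c.2.comp (u (Fin.last (n + k))).kind)

theorem xi_path (n k : ℕ) (u : Fin (n + k) → Letter) (K : Kind) (j : ℤ) :
    xi n k (u, K.path (n + k) j) = ((classOf n k u).1, ((classOf n k u).2.comp K).path n j) := by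
  induction k generalizing K with
  | zero => rfl
  | succ k ih =>
    have : xiStep (n + k) (u, K.path (n + k + 1) j) =
        (Fin.init u, ((u (Fin.last (n + k))).kind.comp K).path (n + k) j) :=
      Prod.ext rfl (Letter.map_path _ _ _ _)
    change xi n k (xiStep (n + k) (u, K.path (n + k + 1) j)) = _
    rw [this, ih, ← Kind.comp_assoc]
    rfl

theorem xi_place (n k : ℕ) (u : Fin (n + k) → Letter) (j : ℤ) :
    xi n k (u, place (n + k) j) = ((classOf n k u).1, (classOf n k u).2.path n j) := by
  have := xi_path n k u .mid j
  rwa [Kind.comp_mid] at this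

instance : Finite Letter := by
  refine Finite.of_surjective (fun i : Fin 6 =>
    (![.L₁, .L₂, .M₁, .M₂, .G₁, .G₂] : Fin 6 → Letter) i) ?_
  rintro (_ | _)
  exacts [⟨0, rfl⟩, ⟨1, rfl⟩, ⟨2, rfl⟩, ⟨3, rfl⟩, ⟨4, rfl⟩, ⟨5, rfl⟩]

/-- The first added letter realizes the prescribed kind; each of the `k` further letters may be `M₁`
or `M₂`, a free binary choice that leaves the class unchanged. -/
theorem two_pow_le_card_classOf (n k : ℕ) (c : (Fin n → Letter) × Kind) :
    2 ^ k ≤ Nat.card {u : Fin (n + (k + 1)) → Letter // classOf n (k + 1) u = c} := by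
  induction k with
  | zero =>
    have : ∃ a : Letter, a.kind = c.2 := by
      obtain ⟨w, K⟩ := c
      cases K
      exacts [⟨.L₁, rfl⟩, ⟨.M₁, rfl⟩, ⟨.G₁, rfl⟩]
    obtain ⟨a, ha⟩ := this
    have : Nonempty {u : Fin (n + (0 + 1)) → Letter // classOf n (0 + 1) u = c} := by
      refine ⟨⟨Fin.snoc (α := fun _ => Letter) (n := n) c.1 a, ?_⟩⟩
      refine Prod.ext ?_ ?_
      · exact Fin.init_snoc (α := fun _ => Letter) (n := n) a c.1
      · change Letter.kind (Fin.snoc (α := fun _ => Letter) (n := n) c.1 a (Fin.last n)) = c.2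
        rw [Fin.snoc_last, ha]
    exact Nat.card_pos
  | succ k ih =>
    let f : {u : Fin (n + (k + 1)) → Letter // classOf n (k + 1) u = c} × Bool →
        {u : Fin (n + (k + 1 + 1)) → Letter // classOf n (k + 1 + 1) u = c} := fun p =>
      ⟨Fin.snoc (α := fun _ => Letter) (n := n + (k + 1)) p.1.1 (cond p.2 .M₁ .M₂), by
        refine Eq.trans ?_ p.1.2
        have h1 : Fin.init (n := n + (k + 1)) (α := fun _ => Letter)
          (Fin.snoc (α := fun _ => Letter) (n := n + (k + 1)) p.1.1 (cond p.2 .M₁ .M₂)) = p.1.1 :=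
          Fin.init_snoc (α := fun _ => Letter) _ _
        refine Prod.ext ?_ ?_
        · change (classOf n (k + 1) (Fin.init (n := n + (k + 1)) (α := fun _ => Letter) _)).1 = _
          rw [h1]
        · change (classOf n (k + 1) (Fin.init (n := n + (k + 1)) (α := fun _ => Letter) _)).2.comp
            (Letter.kind (Fin.snoc (α := fun _ => Letter) (n := n + (k + 1)) p.1.1
              (cond p.2 .M₁ .M₂) (Fin.last _))) = _
          rw [h1, Fin.snoc_last]
          cases p.2 <;> exact Kind.comp_mid _⟩
    have hf : Function.Injective f := by
      rintro ⟨u, b⟩ ⟨u', b'⟩ h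
      have h' := congrArg Subtype.val h
      have h1 := congrArg (Fin.init (n := n + (k + 1)) (α := fun _ => Letter)) h'
      have h2 := congrFun h' (Fin.last (n + (k + 1)))
      simp only [f, Fin.init_snoc, Fin.snoc_last] at h1 h2
      refine Prod.ext (Subtype.ext h1) ?_
      cases b <;> cases b' <;> simp_all
    have := Nat.card_le_card_of_injective f hf
    rw [Nat.card_prod, Nat.card_eq_fintype_card (α := Bool), Fintype.card_bool] at this
    calc 2 ^ (k + 1) = 2 ^ k * 2 := pow_succ _ _
      _ ≤ _ := Nat.mul_le_mul_right 2 ih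
      _ ≤ _ := this

/-! ### Lifting morphisms through the canonical maps -/

theorem place_zero_mid {n : ℕ} (hn : 1 ≤ n) : place n 0 = .m ⟨0, by constructor <;> omega⟩ :=
  place_mid _

/-- The image of the crossing walk is a walk, hence a shifted standard one. Every cycle point of the
`p`-spiral also lies on the crossing walk, arbitrarily far out, so its image is forced; `n! ∣ p!`
makes the resulting formula depend on residues only. -/
theorem exists_word_path {n p : ℕ} (hn : 1 ≤ n) (hnp : n ≤ p) (f : W p → W n)
    (hR : ∀ x y, R p x y → R n (f x) (f y)) (v : Fin p → Letter) :
    ∃ (w : Fin n → Letter) (K : Kind) (s : ℤ), ∀ (T : Kind) (j : ℤ),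
      f (v, T.path p j) = (w, (K.comp T).path n (j - s)) := by
  have hstep : ∀ j, R n (f (v, place p j)) (f (v, place p (j + 1))) := fun j =>
    hR _ _ ⟨rfl, rel_place (hn.trans hnp) j⟩
  obtain ⟨K, s, hK⟩ := exists_path_eq hn (fun j => (f (v, place p j)).2) fun j => (hstep j).2
  have hw : ∀ j, (f (v, place p j)).1 = (f (v, place p 0)).1 := by
    intro j
    induction j using Int.induction_on with
    | zero => rfl
    | succ i ih => rw [← (hstep i).1, ih]
    | pred i ih =>
      have := (hstep (-i - 1)).1
      rw [sub_add_cancel] at this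
      rw [this, ih]
  obtain ⟨w, hplace⟩ : ∃ w : Fin n → Letter, ∀ j, f (v, place p j) = (w, K.path n (j - s)) :=
    ⟨(f (v, place p 0)).1, fun j => Prod.ext (hw j) (hK j)⟩
  have hdvd := Nat.factorial_dvd_factorial hnp
  refine ⟨w, K, s, fun T i => ?_⟩
  cases T
  · obtain ⟨j, h1, -, h3, h4⟩ := left_eq_place (n := p) i (s - n)
    have h5 := intCast_add_eq (-s) (intCast_eq_of_dvd hdvd h3)
    rw [← sub_eq_add_neg, ← sub_eq_add_neg] at h5
    rw [Kind.path, ← h4, hplace]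
    refine Prod.ext rfl ?_
    cases K
    · exact congrArg Spiral.l h5
    · exact (place_left (by omega)).trans (congrArg Spiral.l h5)
    · exact congrArg Spiral.r h5
  · rw [Kind.comp_mid]
    exact hplace i
  · obtain ⟨j, h1, -, h3, h4⟩ := right_eq_place (n := p) (hn.trans hnp) i (s + n)
    have h5 := intCast_add_eq (-s) (intCast_eq_of_dvd hdvd h3)
    rw [← sub_eq_add_neg, ← sub_eq_add_neg] at h5
    rw [Kind.path, ← h4, hplace]
    refine Prod.ext rfl ?_
    cases K
    · exact congrArg Spiral.l h5
    · exact (place_right (by omega) (by omega)).trans (congrArg Spiral.r h5)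
    · exact congrArg Spiral.r h5

/-- `place N` identifies only integers on the same side beyond `±N` that agree modulo `N!`. After a
shift by `s` they are still beyond `±p`, where `place p` has period `p!`, a divisor of `N!`. -/
theorem factorsThrough_place {p N : ℕ} (hp : 1 ≤ p) (T : Kind) (s : ℤ) (hs : |s| + p ≤ N) :
    Function.FactorsThrough (fun j => T.path p (j + s)) (place N) := by
  have h1 := neg_abs_le s
  have h2 := le_abs_self s
  have hpN : p ≤ N := by have := abs_nonneg s; omega
  have hdvd := Nat.factorial_dvd_factorial hpN
  intro i j hij
  rcases place_eq_cases hij with rfl | ⟨h3, h4, h5⟩ | ⟨h3, h4, -, -, h5⟩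
  · rfl
  all_goals
    have h6 := intCast_add_eq s (intCast_eq_of_dvd hdvd h5)
    cases T
    · simp only [Kind.path, h6]
    · simp only [Kind.path]
      first
      | rw [place_left (by omega), place_left (by omega), h6]
      | rw [place_right (by omega) (by omega), place_right (by omega) (by omega), h6]
    · simp only [Kind.path, h6]

theorem exists_surjective_of_card_le {α β : Type*} [Finite α] [Finite β] [Nonempty β]
    (h : Nat.card β ≤ Nat.card α) : ∃ e : α → β, Function.Surjective e := by
  have := Fintype.ofFinite α
  have := Fintype.ofFinite β
  rw [Nat.card_eq_fintype_card, Nat.card_eq_fintype_card] at h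
  obtain ⟨i⟩ := Function.Embedding.nonempty_of_card_le h
  exact ⟨_, Function.invFun_surjective i.injective⟩

instance (n : ℕ) : Finite (Spiral n) := by
  have : NeZero n.factorial := ⟨n.factorial_ne_zero⟩
  refine Finite.of_surjective
    (fun x : (ZMod n.factorial ⊕ Set.Ioo (-(n : ℤ)) (n : ℤ)) ⊕ ZMod n.factorial =>
      x.elim (Sum.elim Spiral.l Spiral.m) Spiral.r) ?_
  rintro (k | k | k)
  exacts [⟨.inl (.inl k), rfl⟩, ⟨.inl (.inr k), rfl⟩, ⟨.inr k, rfl⟩]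

instance (n : ℕ) : Finite (W n) := inferInstanceAs (Finite ((Fin n → Letter) × Spiral n))

/-- A surjective morphism `W_p → W_n` can be completed to a factorization of a canonical map. -/
theorem exists_comp_eq_xi {n p : ℕ} (hn : 1 ≤ n) (hnp : n ≤ p) (f : W p → W n)
    (hf : Function.Surjective f) (hR : ∀ x y, R p x y → R n (f x) (f y)) :
    ∃ k, 1 ≤ k ∧ p ≤ n + k ∧ ∃ h : W (n + k) → W p, Function.Surjective h ∧
      (∀ x y, R (n + k) x y → R p (h x) (h y)) ∧ ∀ x, f (h x) = xi n k x := by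
  classical
  have hp := hn.trans hnp
  choose w K s hpath using exists_word_path hn hnp f hR
  obtain ⟨M, hM⟩ := Finite.exists_le fun v => (s v).natAbs
  have : Nonempty (Fin p → Letter) := ⟨fun _ => .L₁⟩
  have : Nonempty (Spiral p) := ⟨.l 0⟩
  -- The first summand makes `2 ^ k` at least the number of spirals in `W_p`; the second makes the
  -- new spirals long enough to absorb every shift `s v`.
  let k := Nat.card (Fin p → Letter) + (M + p)
  have hk1 : Nat.card (Fin p → Letter) ≤ 2 ^ k :=
    (Nat.le_add_right _ _).trans (Nat.lt_two_pow_self).le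
  have hk2 : ∀ v, |s v| + p ≤ ((n + (k + 1) : ℕ) : ℤ) := by
    intro v
    have := hM v
    rw [Int.abs_eq_natAbs]
    have : M + p ≤ k := Nat.le_add_left _ _
    omega
  -- `Ok c q`: the word and walk `q` are an admissible image for a spiral on which `ξ` has class
  -- `c`.
  let Ok (c : (Fin n → Letter) × Kind) (q : (Fin p → Letter) × (ℤ → Spiral p)) : Prop :=
    Function.FactorsThrough q.2 (place (n + (k + 1))) ∧
      (∀ j, Spiral.Rel p (q.2 j) (q.2 (j + 1))) ∧ ∀ j, f (q.1, q.2 j) = (c.1, c.2.path n j)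
  have hrel : ∀ (T : Kind) (t j : ℤ), Spiral.Rel p (T.path p (j + t)) (T.path p (j + 1 + t)) := by
    intro T t j
    have := path_rel hp T (j + t)
    rwa [add_right_comm] at this
  have hdefault : ∀ c, ∃ q, Ok c q := by
    intro c
    -- Surjectivity of `f` at a middle point produces a spiral that `f` crosses, since walks of the
    -- other kinds avoid the middle. A crossed spiral contains a preimage of the standard walk of
    -- any kind.
    obtain ⟨⟨v, x⟩, hx⟩ := hf (c.1, place n 0)
    obtain ⟨i, rfl⟩ := place_surjective hp x
    have h1 : f (v, place p i) = _ := hpath v .mid i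
    rw [hx, Kind.comp_mid, place_zero_mid hn] at h1
    have h2 : c.1 = w v := congrArg Prod.fst h1
    have h3 : K v = .mid := by
      have := congrArg Prod.snd h1
      cases hK : K v <;> simp [hK, Kind.path] at this ⊢
    refine ⟨(v, fun j => c.2.path p (j + s v)), factorsThrough_place hp _ _ (hk2 v),
      hrel _ _, fun j => ?_⟩
    simp only [hpath, h3, Kind.comp, add_sub_cancel_right, h2]
    rfl
  have hshift : ∀ v, Ok (w v, K v) (v, fun j => place p (j + s v)) := fun v =>
    ⟨factorsThrough_place hp .mid _ (hk2 v), hrel .mid _, fun j => by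
      have h1 : f (v, place p (j + s v)) = _ := hpath v .mid (j + s v)
      rwa [add_sub_cancel_right, Kind.comp_mid] at h1⟩
  choose q₀ hq₀ using hdefault
  -- A spiral `v` that does not match the class `c` is replaced by the default choice; a matching
  -- one is covered entirely, by its crossing walk.
  let t (c : (Fin n → Letter) × Kind) (v : Fin p → Letter) : {q // Ok c q} :=
    if h : Ok c (v, fun j => place p (j + s v)) then ⟨_, h⟩ else ⟨q₀ c, hq₀ c⟩
  have he : ∀ c, ∃ e : {u : Fin (n + (k + 1)) → Letter // classOf n (k + 1) u = c} →
      (Fin p → Letter), Function.Surjective e := fun c =>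
    exists_surjective_of_card_le (hk1.trans (two_pow_le_card_classOf n k c))
  choose e he using he
  let H (u : Fin (n + (k + 1)) → Letter) : {q // Ok (classOf n (k + 1) u) q} :=
    t _ (e (classOf n (k + 1) u) ⟨u, rfl⟩)
  have hH : ∀ v, ∃ u, (H u).1 = (v, fun j => place p (j + s v)) := by
    intro v
    obtain ⟨⟨u, hu⟩, huv⟩ := he (w v, K v) v
    -- The class is generalized to a variable so that the dependent choice can be transported along
    -- `hu`.
    have key : ∀ c (hu : classOf n (k + 1) u = c), (H u).1 = (t c (e c ⟨u, hu⟩)).1 := by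
      rintro _ rfl; rfl
    refine ⟨u, ?_⟩
    rw [key _ hu, huv]
    simp only [t]
    rw [dif_pos (hshift v)]
  have hg : ∀ u, ∃ g : Spiral (n + (k + 1)) → Spiral p, (H u).1.2 = g ∘ place (n + (k + 1)) :=
    fun u => (Function.factorsThrough_iff _).1 (H u).2.1
  choose g hg using hg
  have hg' : ∀ u j, g u (place (n + (k + 1)) j) = (H u).1.2 j := fun u j =>
    (congrFun (hg u) j).symm
  have hN : 1 ≤ n + (k + 1) := by omega
  refine ⟨k + 1, by omega, by have := hk2 fun _ => .L₁; have := abs_nonneg (s fun _ => .L₁); omega,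
    fun x => ((H x.1).1.1, g x.1 x.2), ?_, ?_, ?_⟩
  · rintro ⟨v, x⟩
    obtain ⟨i, rfl⟩ := place_surjective hp x
    obtain ⟨u, hu⟩ := hH v
    refine ⟨(u, place (n + (k + 1)) (i - s v)), ?_⟩
    simp only [hg', hu, sub_add_cancel]
    rfl
  · rintro ⟨u, x⟩ ⟨u', y⟩ ⟨rfl : u = u', hxy⟩
    obtain ⟨j, rfl, rfl⟩ := (rel_iff hN).1 hxy
    refine ⟨rfl, ?_⟩
    simp only [hg']
    exact (H u).2.2.1 j
  · rintro ⟨u, x⟩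
    obtain ⟨j, rfl⟩ := place_surjective hN x
    simp only [hg']
    rw [(H u).2.2.2 j, xi_place]

/-! ### The inverse limit of the spirals -/

theorem xiStep_snoc_place (n : ℕ) (w : Fin n → Letter) (a : Letter) (ha : a.kind = .mid) (j : ℤ) :
    xiStep n (Fin.snoc (α := fun _ => Letter) w a, place (n + 1) j) = (w, place n j) := by
  refine Prod.ext (Fin.init_snoc (α := fun _ => Letter) a w) ?_
  change (Fin.snoc (α := fun _ => Letter) w a (Fin.last n)).map (place (n + 1) j) = place n j
  rw [Fin.snoc_last]
  have := a.map_path .mid n j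
  rwa [ha] at this

theorem exists_ne_xiStep_eq {n : ℕ} (hn : 1 ≤ n) (a : W n) :
    ∃ b c : W (n + 1), b ≠ c ∧ xiStep n b = a ∧ xiStep n c = a := by
  obtain ⟨w, x⟩ := a
  obtain ⟨j, rfl⟩ := place_surjective hn x
  refine ⟨_, _, fun h => ?_, xiStep_snoc_place n w .M₁ rfl j, xiStep_snoc_place n w .M₂ rfl j⟩
  have h1 := congrFun (congrArg Prod.fst h) (Fin.last n)
  simp only [Fin.snoc_last] at h1
  cases h1

theorem xiStep_place (n : ℕ) (w : Fin (n + 1) → Letter) (j : ℤ) :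
    xiStep n (w, place (n + 1) j) = (Fin.init w, (w (Fin.last n)).kind.path n j) := by
  refine Prod.ext rfl ?_
  have := (w (Fin.last n)).map_path .mid n j
  rwa [Kind.comp_mid] at this

theorem R_iff {n : ℕ} (hn : 1 ≤ n) {a b : W n} :
    R n a b ↔ ∃ w j, a = (w, place n j) ∧ b = (w, place n (j + 1)) := by
  constructor
  · obtain ⟨w, x⟩ := a
    obtain ⟨w', y⟩ := b
    rintro ⟨rfl : w = w', h⟩
    obtain ⟨j, rfl, rfl⟩ := (rel_iff hn).1 h
    exact ⟨w, j, rfl, rfl⟩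
  · rintro ⟨w, j, rfl, rfl⟩
    exact ⟨rfl, rel_place hn j⟩

theorem R.xiStep {n : ℕ} (hn : 1 ≤ n) {a b : W (n + 1)} (h : R (n + 1) a b) :
    R n (xiStep n a) (xiStep n b) := by
  obtain ⟨w, j, rfl, rfl⟩ := (R_iff (by omega)).1 h
  rw [xiStep_place, xiStep_place]
  exact ⟨rfl, path_rel hn _ j⟩

theorem exists_R_right {n : ℕ} (hn : 1 ≤ n) (a : W n) : ∃ b, R n a b := by
  obtain ⟨w, x⟩ := a
  obtain ⟨j, rfl⟩ := place_surjective hn x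
  exact ⟨_, (R_iff hn).2 ⟨w, j, rfl, rfl⟩⟩

theorem exists_R_left {n : ℕ} (hn : 1 ≤ n) (b : W n) : ∃ a, R n a b := by
  obtain ⟨w, x⟩ := b
  obtain ⟨j, rfl⟩ := place_surjective hn x
  exact ⟨_, (R_iff hn).2 ⟨w, j - 1, rfl, by rw [sub_add_cancel]⟩⟩

theorem R.exists_lift {n : ℕ} (hn : 1 ≤ n) {a b : W n} (h : R n a b) :
    ∃ a' b', R (n + 1) a' b' ∧ CantorDynamics.xiStep n a' = a ∧
      CantorDynamics.xiStep n b' = b := by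
  obtain ⟨w, j, rfl, rfl⟩ := (R_iff hn).1 h
  exact ⟨_, _, (R_iff (by omega)).2 ⟨Fin.snoc (α := fun _ => Letter) w .M₁, j, rfl, rfl⟩,
    xiStep_snoc_place n w .M₁ rfl j, xiStep_snoc_place n w .M₁ rfl (j + 1)⟩

/-- The segment at level `n + 1` is longer by one point at each end. Distinct integers identified at
that level therefore stay on the cycles of level `n` after a unit step. This makes the branching
relations single-valued in both directions on the limit. -/
theorem path_add_eq {n : ℕ} (hn : 1 ≤ n) (K : Kind) {i j c : ℤ} (hc : |c| ≤ 1)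
    (h : place (n + 1) i = place (n + 1) j) : K.path n (i + c) = K.path n (j + c) := by
  have := neg_abs_le c
  have := le_abs_self c
  have hdvd := Nat.factorial_dvd_factorial n.le_succ
  rcases place_eq_cases h with rfl | ⟨h3, h4, h5⟩ | ⟨h3, h4, -, -, h5⟩
  · rfl
  all_goals
    have h6 := intCast_add_eq c (intCast_eq_of_dvd hdvd h5)
    push_cast at h3 h4
    cases K
    · exact congrArg Spiral.l h6
    · simp only [Kind.path]
      first
      | rw [place_left (by omega), place_left (by omega), h6]
      | rw [place_right (by omega) (by omega), place_right (by omega) (by omega), h6]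
    · exact congrArg Spiral.r h6

theorem R.xiStep_right_unique {n : ℕ} (hn : 1 ≤ n) {a b b' : W (n + 1)} (h : R (n + 1) a b)
    (h' : R (n + 1) a b') : CantorDynamics.xiStep n b = CantorDynamics.xiStep n b' := by
  obtain ⟨w, j, rfl, rfl⟩ := (R_iff (by omega)).1 h
  obtain ⟨w', i, h1, rfl⟩ := (R_iff (by omega)).1 h'
  obtain rfl : w = w' := congrArg Prod.fst h1
  rw [xiStep_place, xiStep_place]
  exact Prod.ext rfl (path_add_eq hn _ (by simp) (congrArg Prod.snd h1))

theorem R.xiStep_left_unique {n : ℕ} (hn : 1 ≤ n) {a a' b : W (n + 1)} (h : R (n + 1) a b)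
    (h' : R (n + 1) a' b) : CantorDynamics.xiStep n a = CantorDynamics.xiStep n a' := by
  obtain ⟨w, j, rfl, rfl⟩ := (R_iff (by omega)).1 h
  obtain ⟨w', i, rfl, h1⟩ := (R_iff (by omega)).1 h'
  obtain rfl : w = w' := congrArg Prod.fst h1
  rw [xiStep_place, xiStep_place]
  have := path_add_eq (c := -1) hn (w (Fin.last n)).kind (by simp) (congrArg Prod.snd h1)
  rw [add_neg_cancel_right, add_neg_cancel_right] at this
  exact Prod.ext rfl this

/-- A compatible sequence through a given point of an inverse sequence of surjections. -/
theorem exists_compatible {E : ℕ → Type*} (f : ∀ n, E (n + 1) → E n)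
    (hf : ∀ n, Function.Surjective (f n)) (m : ℕ) (z : E m) :
    ∃ x : ∀ n, E n, x m = z ∧ ∀ n, f n (x (n + 1)) = x n := by
  induction m generalizing E with
  | zero =>
    choose s hs using hf
    exact ⟨fun n => Nat.rec z (fun n y => s n y) n, rfl, fun n => hs n _⟩
  | succ m ih =>
    obtain ⟨x, hx, hc⟩ := ih (E := fun n => E (n + 1)) (fun n => f (n + 1)) (fun n => hf (n + 1)) z
    refine ⟨fun n => Nat.casesOn n (f 0 (x 0)) x, hx, fun n => ?_⟩
    cases n with
    | zero => rfl
    | succ n => exact hc n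

/-- The inverse limit of the spaces `W_n`. -/
structure SpiralLimit : Type u where
  /-- The projection to `W_n`. -/
  coord : ∀ n, W n
  compat : ∀ n, xiStep n (coord (n + 1)) = coord n

namespace SpiralLimit

instance (n : ℕ) : DiscreteTopology (W n) := ⟨rfl⟩

instance : TopologicalSpace SpiralLimit.{u} := .induced coord inferInstance

theorem ext_coord {x y : SpiralLimit.{u}} (h : ∀ n, x.coord n = y.coord n) : x = y := by
  cases x; cases y; congr 1; exact funext h

theorem continuous_coord (n : ℕ) : Continuous fun x : SpiralLimit.{u} => x.coord n :=
  (continuous_apply n).comp continuous_induced_dom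

theorem isClosedEmbedding_coord : IsClosedEmbedding (coord : SpiralLimit.{u} → ∀ n, W n) := by
  refine ⟨⟨⟨rfl⟩, fun x y h => ext_coord (congrFun h)⟩, ?_⟩
  have : Set.range (coord : SpiralLimit.{u} → ∀ n, W n) =
      ⋂ n, {x | xiStep n (x (n + 1)) = x n} := by
    ext x
    simp only [Set.mem_range, Set.mem_iInter, Set.mem_ofPred_eq]
    exact ⟨by rintro ⟨y, rfl⟩; exact y.compat, fun h => ⟨⟨x, h⟩, rfl⟩⟩
  rw [this]
  exact isClosed_iInter fun n =>
    isClosed_eq ((continuous_of_discreteTopology (f := xiStep n)).comp (continuous_apply (n + 1)))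
      (continuous_apply n)

instance : CompactSpace SpiralLimit.{u} := isClosedEmbedding_coord.compactSpace

instance : T2Space SpiralLimit.{u} := isClosedEmbedding_coord.isEmbedding.t2Space

instance : TotallyDisconnectedSpace SpiralLimit.{u} :=
  (Topology.IsEmbedding.isTotallyDisconnected_range isClosedEmbedding_coord.isEmbedding).1
    (isTotallyDisconnected_of_totallyDisconnectedSpace _)

theorem exists_coord_eq {n : ℕ} (hn : 1 ≤ n) (a : W n) : ∃ x : SpiralLimit.{u}, x.coord n = a := by
  obtain ⟨m, rfl⟩ : ∃ m, n = m + 1 := ⟨n - 1, by omega⟩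
  obtain ⟨x, hx, hc⟩ := exists_compatible (E := fun n => W (n + 1)) (fun n => xiStep (n + 1))
    (fun n b => by
      obtain ⟨c, -, -, h, -⟩ := exists_ne_xiStep_eq (n := n + 1) (by omega) b
      exact ⟨c, h⟩) m a
  refine ⟨⟨fun n => Nat.casesOn n (xiStep 0 (x 0)) x, fun n => ?_⟩, hx⟩
  cases n with
  | zero => rfl
  | succ n => exact hc n

instance : Nonempty SpiralLimit.{u} :=
  (exists_coord_eq le_rfl ((fun _ => .L₁, .l 0) : (Fin 1 → Letter) × Spiral 1)).nonempty

theorem xi_coord (x : SpiralLimit.{u}) (n k : ℕ) : xi n k (x.coord (n + k)) = x.coord n := by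
  induction k with
  | zero => rfl
  | succ k ih =>
    rw [← ih, ← x.compat (n + k)]
    rfl

theorem coord_eq_of_le {x y : SpiralLimit.{u}} {m n : ℕ} (hmn : m ≤ n)
    (h : x.coord n = y.coord n) : x.coord m = y.coord m := by
  obtain ⟨k, rfl⟩ := Nat.exists_eq_add_of_le hmn
  rw [← xi_coord x, ← xi_coord y, h]

/-- A locally constant function depends on a single coordinate only. -/
theorem exists_forall_coord_eq {β : Type*} {g : SpiralLimit.{u} → β} (hg : IsLocallyConstant g) :
    ∃ N, ∀ m, N ≤ m → ∀ x y : SpiralLimit.{u}, x.coord m = y.coord m → g x = g y := by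
  by_contra! hcon
  -- If no coordinate suffices, compactness gives a point common to all the `C m`: two points with
  -- all coordinates equal but different values of `g`.
  let C (m : ℕ) : Set (SpiralLimit.{u} × SpiralLimit.{u}) :=
    {p | p.1.coord m = p.2.coord m} ∩ {p | g p.1 ≠ g p.2}
  have hg2 : IsOpen {p : SpiralLimit.{u} × SpiralLimit.{u} | g p.1 = g p.2} :=
    ((hg.comp_continuous continuous_fst).prodMk (hg.comp_continuous continuous_snd))
      {q | q.1 = q.2}
  have hC : ∀ m, IsClosed (C m) := fun m =>
    (isClosed_eq ((continuous_coord m).comp continuous_fst)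
      ((continuous_coord m).comp continuous_snd)).inter hg2.isClosed_compl
  have hanti : ∀ m, C (m + 1) ⊆ C m := fun m p hp => ⟨coord_eq_of_le m.le_succ hp.1, hp.2⟩
  obtain ⟨p, hp⟩ := IsCompact.nonempty_iInter_of_sequence_nonempty_isCompact_isClosed C hanti
    (fun m => by
      obtain ⟨n, hn, x, y, h1, h2⟩ := hcon m
      exact ⟨(x, y), coord_eq_of_le hn h1, h2⟩) (hC 0).isCompact hC
  rw [Set.mem_iInter] at hp
  exact (hp 0).2 (congrArg g (ext_coord fun n => (hp n).1))

instance : PerfectSpace SpiralLimit.{u} := by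
  rw [perfectSpace_iff_forall_not_isolated]
  intro x
  by_contra hx
  rw [Filter.not_neBot, ← isOpen_singleton_iff_punctured_nhds] at hx
  have hlc : IsLocallyConstant fun y : SpiralLimit.{u} => y = x := by
    rw [IsLocallyConstant.iff_isOpen_fiber]
    intro p
    by_cases hp : p
    · simpa [hp] using hx
    · have : (fun y : SpiralLimit.{u} => y = x) ⁻¹' {p} = {x}ᶜ := by ext; simp [hp]
      rw [this]
      exact isClosed_singleton.isOpen_compl
  obtain ⟨N, hN⟩ := exists_forall_coord_eq hlc
  -- An isolated point would be determined by one coordinate, but the letters `M₁` and `M₂` give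
  -- that coordinate two lifts.
  obtain ⟨b, c, hbc, hb, hc⟩ := exists_ne_xiStep_eq (n := N + 1) (by omega) (x.coord (N + 1))
  obtain ⟨y, rfl⟩ := exists_coord_eq.{u} (by omega) b
  obtain ⟨z, rfl⟩ := exists_coord_eq.{u} (by omega) c
  rw [compat] at hb hc
  have hy := hN _ N.le_succ y x hb
  have hz := hN _ N.le_succ z x hc
  simp only [eq_iff_iff, iff_true] at hy hz
  rw [hy, hz] at hbc
  exact hbc rfl

/-- Successors at one level are not unique, but their images one level down are. Stated for a
general `Q` so that it yields the shift and its inverse. -/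
theorem exists_map_of_rel (Q : ∀ n, W n → W n → Prop) (hex : ∀ n, 1 ≤ n → ∀ a, ∃ b, Q n a b)
    (hmap : ∀ n, 1 ≤ n → ∀ a b, Q (n + 1) a b → Q n (xiStep n a) (xiStep n b))
    (huniq : ∀ n, 1 ≤ n → ∀ a b c, Q (n + 1) a b → Q (n + 1) a c → xiStep n b = xiStep n c) :
    ∃ F : SpiralLimit.{u} → SpiralLimit.{u}, Continuous F ∧
      ∀ x n, 1 ≤ n → Q n (x.coord n) ((F x).coord n) := by
  have hex' : ∀ n a, ∃ b, 1 ≤ n → Q n a b := by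
    intro n a
    by_cases hn : 1 ≤ n
    · obtain ⟨b, hb⟩ := hex n hn a
      exact ⟨b, fun _ => hb⟩
    · exact ⟨a, fun h => absurd h hn⟩
  choose s hs using hex'
  let F (x : SpiralLimit.{u}) : SpiralLimit.{u} :=
    -- Descending two levels rather than one keeps the use of `huniq` at level `n + 1`, so that the
    -- coordinate `n = 0` is covered.
    ⟨fun n => xiStep n (xiStep (n + 1) (s (n + 2) (x.coord (n + 2)))), fun n => by
      congr 1
      refine huniq (n + 1) (by omega) (x.coord (n + 2)) _ _ ?_ (hs _ _ (by omega))
      have := hmap (n + 2) (by omega) _ _ (hs (n + 3) (x.coord (n + 3)) (by omega))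
      rwa [x.compat] at this⟩
  refine ⟨F, ?_, fun x n hn => ?_⟩
  · rw [continuous_induced_rng]
    refine continuous_pi fun n => ?_
    exact (continuous_of_discreteTopology
      (f := fun a => xiStep n (xiStep (n + 1) (s (n + 2) a)))).comp (continuous_coord (n + 2))
  · have := hmap n hn _ _ (hmap (n + 1) (by omega) _ _ (hs (n + 2) (x.coord (n + 2)) (by omega)))
    rwa [x.compat, x.compat] at this

/-- The relations `R_n` induce a homeomorphism of the inverse limit. -/
theorem exists_shift : ∃ σ : SpiralLimit.{u} ≃ₜ SpiralLimit.{u},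
    ∀ x n, 1 ≤ n → R n (x.coord n) ((σ x).coord n) := by
  obtain ⟨F, hF, hFR⟩ := exists_map_of_rel.{u} R (fun n hn => exists_R_right hn)
    (fun n hn a b h => h.xiStep hn) (fun n hn a b c h h' => h.xiStep_right_unique hn h')
  obtain ⟨G, hG, hGR⟩ := exists_map_of_rel.{u} (fun n a b => R n b a) (fun n hn => exists_R_left hn)
    (fun n hn a b h => h.xiStep hn) (fun n hn a b c h h' => h.xiStep_left_unique hn h')
  have aux : ∀ {n : ℕ} {x y : SpiralLimit.{u}},
      xiStep (n + 1) (x.coord (n + 2)) = xiStep (n + 1) (y.coord (n + 2)) →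
      x.coord n = y.coord n := fun {n x y} h => by
    rw [compat, compat] at h
    exact coord_eq_of_le n.le_succ h
  refine ⟨⟨⟨F, G, fun x => ext_coord fun n => aux ?_, fun x => ext_coord fun n => aux ?_⟩,
    hF, hG⟩, hFR⟩
  · exact (hGR (F x) (n + 2) (by omega)).xiStep_left_unique (by omega) (hFR x (n + 2) (by omega))
  · exact (hFR (G x) (n + 2) (by omega)).xiStep_right_unique (by omega) (hGR x (n + 2) (by omega))

theorem exists_coord_eq_shift (σ : SpiralLimit.{u} ≃ₜ SpiralLimit.{u})
    (hσ : ∀ x n, 1 ≤ n → R n (x.coord n) ((σ x).coord n)) {n : ℕ} (hn : 1 ≤ n) {a b : W n}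
    (h : R n a b) : ∃ x : SpiralLimit.{u}, x.coord n = a ∧ (σ x).coord n = b := by
  obtain ⟨a', b', h', rfl, rfl⟩ := h.exists_lift hn
  obtain ⟨x, rfl⟩ := exists_coord_eq.{u} (by omega) a'
  refine ⟨x, (x.compat n).symm, ?_⟩
  rw [← compat]
  exact (hσ x (n + 1) (by omega)).xiStep_right_unique hn h'

/-- The inverse limit of the spirals has the lifting property. -/
theorem topLiftingProperty (σ : SpiralLimit.{u} ≃ₜ SpiralLimit.{u})
    (hσ : ∀ x n, 1 ≤ n → R n (x.coord n) ((σ x).coord n)) : TopLiftingProperty σ := by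
  refine ⟨⟨1, le_rfl, fun x => x.coord 1, continuous_coord 1, exists_coord_eq le_rfl,
    fun x => hσ x 1 le_rfl⟩, ?_⟩
  rintro n hn φ ⟨hφc, hφs, hφR⟩ A ⟨hA, hAc⟩ -
  choose cell hcell huniq using hA.2
  have hlc : IsLocallyConstant cell := by
    rw [IsLocallyConstant.iff_exists_open]
    refine fun x => ⟨cell x, (hAc _ (hcell x).1).isOpen, (hcell x).2, fun y hy => ?_⟩
    exact (huniq y (cell x) ⟨(hcell x).1, hy⟩).symm
  obtain ⟨N₁, hN₁⟩ := exists_forall_coord_eq ((IsLocallyConstant.iff_continuous φ).2 hφc)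
  obtain ⟨N₂, hN₂⟩ := exists_forall_coord_eq hlc
  obtain ⟨m, hm1, hm2, hmn⟩ : ∃ m, N₁ ≤ m ∧ N₂ ≤ m ∧ n ≤ m :=
    ⟨N₁ + N₂ + n, by omega, by omega, by omega⟩
  have hm : 1 ≤ m := hn.trans hmn
  choose s hs using fun a : W m => exists_coord_eq.{u} hm a
  have hf : ∀ x, φ x = φ (s (x.coord m)) := fun x => hN₁ m hm1 _ _ (hs _).symm
  obtain ⟨k, hk, hmk, h, hh, hhR, hhf⟩ := exists_comp_eq_xi hn hmn (fun a => φ (s a))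
    (fun b => by
      obtain ⟨x, rfl⟩ := hφs b
      exact ⟨x.coord m, (hf x).symm⟩)
    (fun a b hab => by
      obtain ⟨x, rfl, rfl⟩ := exists_coord_eq_shift σ hσ hm hab
      rw [← hf, ← hf]
      exact hφR x)
  -- The second completion, now of `h`: since `h ∘ q = ξ`, the map `q ∘ coord (m + j)` determines
  -- the coordinate `m`, hence the cell of `A`, and it lifts `φ` because `f ∘ h = ξ`.
  obtain ⟨j, -, -, q, hq, hqR, hqh⟩ := exists_comp_eq_xi hm hmk h hh hhR
  have hψ : ∀ x : SpiralLimit.{u}, h (q (x.coord (m + j))) = x.coord m := fun x => by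
    rw [hqh, xi_coord]
  refine ⟨k, hk, fun x => q (x.coord (m + j)),
    ⟨continuous_of_discreteTopology.comp (continuous_coord _), fun b => ?_,
      fun x => hqR _ _ (hσ x _ (by omega))⟩, ?_, funext fun x => ?_⟩
  · obtain ⟨a, rfl⟩ := hq b
    obtain ⟨x, rfl⟩ := exists_coord_eq.{u} (by omega) a
    exact ⟨x, rfl⟩
  · rintro _ ⟨b, rfl⟩
    obtain ⟨a, rfl⟩ := hq b
    obtain ⟨x, rfl⟩ := exists_coord_eq.{u} (by omega) a
    refine ⟨cell x, (hcell x).1, fun y hy => ?_⟩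
    have hxy : y.coord m = x.coord m := by
      rw [← hψ y, ← hψ x]
      exact congrArg h hy
    rw [← hN₂ m hm2 _ _ hxy]
    exact (hcell y).2
  · rw [hf x, ← hψ x]
    exact hhf _

end SpiralLimit

/-! ### Itineraries in systems with the lifting property -/

/-- Either the walk leaves the left cycle at some time, and then follows the line into the right
cycle, or it circles in the left cycle forever. -/
theorem Spiral.eventually_periodic {n : ℕ} (hn : 1 ≤ n) (x : ℕ → Spiral n)
    (hx : ∀ j, Spiral.Rel n (x j) (x (j + 1))) :
    ∃ J P, 1 ≤ P ∧ ∀ j, J ≤ j → x (j + P) = x j := by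
  have hP : 1 ≤ n.factorial := n.factorial_pos
  by_cases h : ∃ (j : ℕ) (i : ℤ), -(n : ℤ) < i ∧ x j = place n i
  · obtain ⟨j, i, hi, hj⟩ := h
    have key : ∀ t : ℕ, x (j + t) = place n (i + t) := by
      intro t
      induction t with
      | zero => simpa using hj
      | succ t ih =>
        have := hx (j + t)
        rw [ih] at this
        have := rel_forward_place hn (by omega) this
        rw [← add_assoc, this]; congr 1; push_cast; ring
    -- From `-n < i`, after `2n` steps the walk is past `n`.
    refine ⟨j + 2 * n, n.factorial, hP, fun k hk => ?_⟩
    obtain ⟨t, rfl⟩ := Nat.exists_eq_add_of_le hk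
    rw [add_assoc, add_assoc, add_assoc, key, key, place_right (by push_cast; omega) (by omega),
      place_right (by push_cast; omega) (by omega)]
    push_cast
    have : ((n.factorial : ℕ) : ZMod n.factorial) = 0 := ZMod.natCast_self _
    rw [this, add_zero]
  · have hl : ∀ j, ∃ k, x j = .l k := by
      intro j
      obtain ⟨i, hi⟩ := place_surjective hn (x j)
      by_cases hi' : -(n : ℤ) < i
      · exact absurd ⟨j, i, hi', hi.symm⟩ h
      · exact ⟨_, hi.symm.trans (place_left (not_lt.1 hi'))⟩
    obtain ⟨k, hk⟩ := hl 0
    have key : ∀ t : ℕ, x t = .l (k + t) := by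
      intro t
      induction t with
      | zero => simpa using hk
      | succ t ih =>
        have := hx t
        rw [ih] at this
        rcases rel_forward_left this with h1 | ⟨k', h1⟩
        · rw [h1]; congr 1; push_cast; ring
        · obtain ⟨k'', h2⟩ := hl (t + 1)
          rw [h1] at h2; cases h2
    refine ⟨0, n.factorial, hP, fun j _ => ?_⟩
    rw [key, key]
    push_cast
    rw [ZMod.natCast_self, add_zero]

theorem W_eventually_periodic {n : ℕ} (hn : 1 ≤ n) (x : ℕ → W n)
    (hx : ∀ j, R n (x j) (x (j + 1))) : ∃ J P, 1 ≤ P ∧ ∀ j, J ≤ j → x (j + P) = x j := by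
  obtain ⟨J, P, hP, h⟩ := Spiral.eventually_periodic hn (fun j => (x j).2) fun j => (hx j).2
  have hw : ∀ j, (x j).1 = (x 0).1 := by
    intro j
    induction j with
    | zero => rfl
    | succ j ih => rw [← (hx j).1, ih]
  exact ⟨J, P, hP, fun j hj => Prod.ext ((hw _).trans (hw _).symm) (h j hj)⟩

/-- In a system with the lifting property, every itinerary with respect to a clopen set is
eventually periodic. -/
theorem TopLiftingProperty.eventually_periodic {Y : Type*} [TopologicalSpace Y] {τ : Y ≃ₜ Y}
    (h : TopLiftingProperty τ) {D : Set Y} (hD : IsClopen D) (y : Y) :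
    ∃ J P, 1 ≤ P ∧ ∀ j, J ≤ j → (τ^[j + P] y ∈ D ↔ τ^[j] y ∈ D) := by
  obtain ⟨⟨n, hn, φ, hφ⟩, hlift⟩ := h
  -- The fibres of `g` are the common refinement of `A_φ` and the partition into `D` and its
  -- complement.
  let g : Y → W n × Prop := fun y => (φ y, y ∈ D)
  have hg : ∀ y, IsClopen {z | g z = g y} := by
    intro y
    have h1 : IsClopen (φ ⁻¹' {φ y}) := (isClopen_discrete _).preimage hφ.1
    by_cases hy : y ∈ D
    · convert h1.inter hD using 1
      ext z; simp [g, hy]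
    · convert h1.inter hD.compl using 1
      ext z; simp [g, hy]
  obtain ⟨k, -, ψ, ⟨-, -, hψR⟩, href, -⟩ := hlift n hn φ hφ (Setoid.ker g).classes
    ⟨Setoid.isPartition_classes _, by rintro _ ⟨y, rfl⟩; exact hg y⟩
    (by
      rintro _ ⟨y, rfl⟩
      exact ⟨φ ⁻¹' {φ y}, ⟨φ y, rfl⟩, fun z hz => congrArg Prod.fst hz⟩)
  obtain ⟨J, P, hP, hper⟩ := W_eventually_periodic (by omega) (fun j => ψ (τ^[j] y)) (fun j => by
    simp only [Function.iterate_succ_apply']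
    exact hψR _)
  refine ⟨J, P, hP, fun j hj => ?_⟩
  obtain ⟨_, ⟨z, rfl⟩, hz⟩ := href _ ⟨ψ (τ^[j] y), rfl⟩
  have h1 : g (τ^[j + P] y) = g z := hz (hper j hj)
  have h2 : g (τ^[j] y) = g z := hz rfl
  exact iff_of_eq (congrArg Prod.snd (h1.trans h2.symm))

theorem not_eventually_periodic_isSquare (J P : ℕ) (hP : 1 ≤ P) :
    ∃ j, J ≤ j ∧ ¬ (IsSquare (j + P) ↔ IsSquare j) := by
  -- The next square exceeds this one by `2 (J + P) + 1 > P`.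
  refine ⟨(J + P) * (J + P), by nlinarith, fun h => ?_⟩
  obtain ⟨r, hr⟩ := h.2 ⟨_, rfl⟩
  have h1 : J + P < r := by
    by_contra h'
    have := Nat.mul_le_mul (not_lt.1 h') (not_lt.1 h')
    omega
  have := Nat.mul_le_mul (Nat.succ_le_of_lt h1) (Nat.succ_le_of_lt h1)
  simp only [Nat.succ_eq_add_one] at this
  nlinarith

/-- An orbit through the middle point `place n 0` never returns to its fibre; injectivity of `σ`
reduces any coincidence on the orbit to such a return. -/
theorem IsFactorMap.exists_injective_orbit {X : Type*} [TopologicalSpace X] {σ : X ≃ₜ X} {n : ℕ}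
    (hn : 1 ≤ n) {φ : X → W n} (hφ : IsFactorMap σ n φ) :
    ∃ x, Function.Injective fun j : ℕ => σ^[j] x := by
  obtain ⟨x, hx⟩ := hφ.2.1 ((fun _ => .L₁, place n 0) : (Fin n → Letter) × Spiral n)
  have key : ∀ j : ℕ, (φ (σ^[j] x)).2 = place n j := by
    intro j
    induction j with
    | zero => rw [Function.iterate_zero_apply, hx]; rfl
    | succ j ih =>
      have := (hφ.2.2 (σ^[j] x)).2
      rw [ih] at this
      rw [Function.iterate_succ_apply', rel_forward_place hn (by omega) this]
      congr 1
  have hne : ∀ a d : ℕ, σ^[a] x = σ^[a + (d + 1)] x → False := by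
    intro a d h
    rw [Function.iterate_add_apply] at h
    have h1 := σ.injective.iterate a h
    have h2 : place n ((0 : ℕ) : ℤ) = place n ((d + 1 : ℕ) : ℤ) := by
      rw [← key, ← key, ← h1]; rfl
    rcases place_eq_cases h2 with h | h | h
    · omega
    · omega
    · omega
  refine ⟨x, fun a b h => ?_⟩
  rcases lt_trichotomy a b with hab | hab | hab
  · obtain ⟨d, rfl⟩ := Nat.exists_eq_add_of_lt hab
    exact (hne a d h).elim
  · exact hab
  · obtain ⟨d, rfl⟩ := Nat.exists_eq_add_of_lt hab
    exact (hne b d h.symm).elim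

/-- Finite stretches of the itinerary of a point with infinite orbit may be prescribed. -/
theorem exists_isClopen_itinerary {X : Type*} [TopologicalSpace X] [CompactSpace X] [T2Space X]
    [TotallyDisconnectedSpace X] {σ : X → X} {x : X}
    (hx : Function.Injective fun j : ℕ => σ^[j] x) (q : ℕ → Prop) (i : ℕ) :
    ∃ D : Set X, IsClopen D ∧ ∀ j ≤ i, (σ^[j] x ∈ D ↔ q j) := by
  have hfin : ∀ r : ℕ → Prop, ((fun j : ℕ => σ^[j] x) '' {j | j ≤ i ∧ r j}).Finite := fun r =>
    ((Set.finite_Iic i).subset fun j hj => hj.1).image _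
  obtain ⟨D, hD, h1, h2⟩ := exists_clopen_of_closed_subset_open (hfin q).isClosed
    (hfin fun j => ¬ q j).isClosed.isOpen_compl (by
      rintro _ ⟨j, hj, rfl⟩ ⟨k, hk, h⟩
      obtain rfl : k = j := hx h
      exact hk.2 hj.2)
  refine ⟨D, hD, fun j hj => ⟨fun h => ?_, fun h => h1 ⟨j, ⟨hj, h⟩, rfl⟩⟩⟩
  by_contra hq
  exact h2 h ⟨j, ⟨hj, hq⟩, rfl⟩

/-! ### Ultrapowers of algebras of continuous functions -/

/-- A norm-bounded sequence as a bounded continuous function. -/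
def boundedSeq {A : Type*} [CommCStarAlgebra A] (a : ℕ → A) (C : ℝ) (h : ∀ n, ‖a n‖ ≤ C) :
    ℕ →ᵇ A :=
  BoundedContinuousFunction.ofNormedAddCommGroup a continuous_of_discreteTopology C h

/-- The indicator function of a clopen set. -/
def indicatorMap {X : Type*} [TopologicalSpace X] {D : Set X} (hD : IsClopen D) : C(X, ℂ) :=
  ⟨D.indicator 1, (LocallyConstant.coe_charFn ℂ hD) ▸ (LocallyConstant.charFn ℂ hD).continuous⟩

section

variable {X : Type*} [TopologicalSpace X] {D : Set X} (hD : IsClopen D)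

theorem indicatorMap_of_mem {x : X} (hx : x ∈ D) : indicatorMap hD x = 1 :=
  Set.indicator_of_mem hx _

theorem indicatorMap_of_notMem {x : X} (hx : x ∉ D) : indicatorMap hD x = 0 :=
  Set.indicator_of_notMem hx _

theorem indicatorMap_mul_self : indicatorMap hD * indicatorMap hD = indicatorMap hD := by
  ext x
  by_cases hx : x ∈ D
  · simp [indicatorMap_of_mem hD hx]
  · simp [indicatorMap_of_notMem hD hx]

theorem norm_indicatorMap_le [CompactSpace X] : ‖indicatorMap hD‖ ≤ 1 := by
  rw [ContinuousMap.norm_le _ zero_le_one]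
  intro x
  by_cases hx : x ∈ D
  · simp [indicatorMap_of_mem hD hx]
  · simp [indicatorMap_of_notMem hD hx]

theorem isClopen_of_mul_self_eq {p : C(X, ℂ)} (hp : p * p = p) : IsClopen {x | p x = 1} := by
  refine ⟨isClosed_eq p.continuous continuous_const, ?_⟩
  have : {x | p x = 1} = {x | p x = 0}ᶜ := by
    ext x
    have hx : p x * p x = p x := DFunLike.congr_fun hp x
    constructor
    · intro h h'
      rw [Set.mem_ofPred_eq] at h h'
      rw [h] at h'
      exact one_ne_zero h'
    · intro h
      exact mul_right_cancel₀ (h : p x ≠ 0) (hx.trans (one_mul _).symm)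
  rw [this]
  exact (isClosed_eq p.continuous continuous_const).isOpen_compl

end

variable {X : Type*} [TopologicalSpace X] [CompactSpace X] (U : Ultrafilter ℕ)

/-- The sequence of the indicator functions of a sequence of clopen sets. -/
def indicatorSeq {D : ℕ → Set X} (hD : ∀ n, IsClopen (D n)) : ℕ →ᵇ C(X, ℂ) :=
  boundedSeq (fun n => indicatorMap (hD n)) 1 fun n => norm_indicatorMap_le (hD n)

theorem mk_indicatorSeq_mul_self {D : ℕ → Set X} (hD : ∀ n, IsClopen (D n)) :
    (Ideal.Quotient.mk (nullIdeal C(X, ℂ) U) (indicatorSeq hD)) *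
      Ideal.Quotient.mk (nullIdeal C(X, ℂ) U) (indicatorSeq hD) =
      Ideal.Quotient.mk (nullIdeal C(X, ℂ) U) (indicatorSeq hD) := by
  rw [← map_mul]
  congr 1
  ext1 n
  exact indicatorMap_mul_self (hD n)

theorem exists_tendsto_eval (x : X) (a : ℕ →ᵇ C(X, ℂ)) :
    ∃ c : ℂ, Tendsto (fun n => a n x) U (𝓝 c) := by
  obtain ⟨c, -, hc⟩ := (isCompact_closedBall (0 : ℂ) ‖a‖).ultrafilter_le_nhds
    (U.map fun n => a n x) (by
      rw [le_principal_iff]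
      refine Filter.Eventually.of_forall (f := (U : Filter ℕ)) fun n => ?_
      rw [mem_closedBall_zero_iff]
      exact ((a n).norm_coe_le_norm x).trans (a.norm_coe_le_norm n))
  exact ⟨c, hc⟩

/-- The character of the ultrapower given by a point of `X`. -/
theorem exists_character (x : X) : ∃ χ : Ultrapower C(X, ℂ) U →ₐ[ℂ] ℂ, ∀ a : ℕ →ᵇ C(X, ℂ),
    Tendsto (fun n => a n x) U (𝓝 (χ (Ideal.Quotient.mk (nullIdeal C(X, ℂ) U) a))) := by
  choose L hL using exists_tendsto_eval U x
  have hL' : ∀ {a c}, Tendsto (fun n => a n x) U (𝓝 c) → L a = c := fun {a c} h =>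
    tendsto_nhds_unique (hL a) h
  let f : (ℕ →ᵇ C(X, ℂ)) →ₐ[ℂ] ℂ :=
    { toFun := L
      map_one' := hL' tendsto_const_nhds
      map_mul' := fun a b => hL' ((hL a).mul (hL b))
      map_zero' := hL' tendsto_const_nhds
      map_add' := fun a b => hL' ((hL a).add (hL b))
      commutes' := fun c => hL' tendsto_const_nhds }
  refine ⟨Ideal.Quotient.liftₐ (nullIdeal C(X, ℂ) U) f fun a ha => hL' ?_, fun a => hL a⟩
  exact squeeze_zero_norm (fun n => (a n).norm_coe_le_norm x) ha

theorem ultrapowerAut_mk {A : Type*} [CommCStarAlgebra A] (α : A ≃⋆ₐ[ℂ] A) (a : ℕ →ᵇ A) :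
    ultrapowerAut U α (Ideal.Quotient.mk (nullIdeal A U) a) =
      Ideal.Quotient.mk (nullIdeal A U) (mapSeq α a) := rfl

/-- Every character of `C(Y)` is the evaluation at a point. -/
theorem exists_eval_eq {Y : Type*} [TopologicalSpace Y] [CompactSpace Y] [T2Space Y]
    (χ : C(Y, ℂ) →ₐ[ℂ] ℂ) : ∃ y, ∀ f, χ f = f y := by
  obtain ⟨y, hy⟩ := (WeakDual.CharacterSpace.continuousMapEval_bijective (X := Y) (𝕜 := ℂ)).2
    (WeakDual.CharacterSpace.equivAlgHom.symm χ)
  exact ⟨y, fun f => (DFunLike.congr_fun hy f).symm⟩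

/-- An ultrapower of a system that factors onto some `W_n` does not have the lifting property. -/
theorem not_topLiftingProperty_of_correspondsTo [T2Space X] [TotallyDisconnectedSpace X]
    {σ : X ≃ₜ X} (hσ : ∃ n : ℕ, 1 ≤ n ∧ ∃ φ : X → W n, IsFactorMap σ n φ)
    (hU : ∀ n : ℕ, U ≠ pure n) {Y : Type*} [TopologicalSpace Y] [CompactSpace Y] [T2Space Y]
    {τ : Y ≃ₜ Y} (hτ : CorrespondsTo (ultrapowerAut U (inducedAut σ)) τ) :
    ¬ TopLiftingProperty τ := by
  intro hlift
  obtain ⟨n, hn, φ, hφ⟩ := hσ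
  obtain ⟨x, hx⟩ := hφ.exists_injective_orbit hn
  choose D hD hDx using exists_isClopen_itinerary hx IsSquare
  obtain ⟨e, he⟩ := hτ
  choose χ hχ using exists_character (X := X) U
  set p := Ideal.Quotient.mk (nullIdeal C(X, ℂ) U) (indicatorSeq hD) with hp
  have hchi : ∀ z a, χ z (ultrapowerAut U (inducedAut σ) a) = χ (σ z) a := by
    intro z a
    obtain ⟨a, rfl⟩ := Ideal.Quotient.mk_surjective a
    rw [ultrapowerAut_mk]
    exact tendsto_nhds_unique (hχ z (mapSeq (inducedAut σ) a)) (hχ (σ z) a)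
  -- Evaluation at `x` along `U` is a point `y` of `Y`; by `hchi` the orbit of `y` consists of the
  -- evaluations along the orbit of `x`.
  obtain ⟨y, hy⟩ := exists_eval_eq ((χ x).comp (e.symm : C(Y, ℂ) →⋆ₐ[ℂ] _).toAlgHom)
  have hy' : ∀ a, e a y = χ x a := by
    intro a
    rw [← hy (e a)]
    exact congrArg (χ x) (e.symm_apply_apply a)
  have horbit : ∀ (j : ℕ) a, e a (τ^[j] y) = χ (σ^[j] x) a := by
    intro j
    induction j with
    | zero => exact hy'
    | succ j ih =>
      intro a
      rw [Function.iterate_succ_apply', Function.iterate_succ_apply', ← hchi, ← ih, he]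
      rfl
  have hmem : ∀ j, τ^[j] y ∈ {z | e p z = 1} ↔ IsSquare j := by
    intro j
    -- Nonprincipality enters here: `U`-almost every `D i` prescribes the itinerary beyond time `j`.
    have hev : ∀ᶠ i in (U : Filter ℕ), j ≤ i := by
      have hle : (U : Filter ℕ) ≤ cofinite :=
        U.le_cofinite_or_eq_pure.resolve_right fun ⟨n, h⟩ => hU n h
      rw [Nat.cofinite_eq_atTop] at hle
      exact hle (eventually_ge_atTop j)
    have hlim := hχ (σ^[j] x) (indicatorSeq hD)
    rw [Set.mem_ofPred_eq, horbit]
    by_cases hj : IsSquare j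
    · have : χ (σ^[j] x) p = 1 := by
        refine tendsto_nhds_unique hlim (tendsto_const_nhds.congr' ?_)
        filter_upwards [hev] with i hi
        exact (indicatorMap_of_mem (hD i) ((hDx i j hi).2 hj)).symm
      simp [this, hj]
    · have : χ (σ^[j] x) p = 0 := by
        refine tendsto_nhds_unique hlim (tendsto_const_nhds.congr' ?_)
        filter_upwards [hev] with i hi
        exact (indicatorMap_of_notMem (hD i) fun h => hj ((hDx i j hi).1 h)).symm
      simp [this, hj]
  have hclopen : IsClopen {z | e p z = 1} :=
    isClopen_of_mul_self_eq (by rw [← map_mul, hp, mk_indicatorSeq_mul_self])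
  obtain ⟨J, P, hP, hper⟩ := hlift.eventually_periodic hclopen y
  obtain ⟨j, hj, hne⟩ := not_eventually_periodic_isSquare J P hP
  exact hne (by rw [← hmem, ← hmem]; exact hper j hj)

/-! ### The space of an ultrapower -/

/-- Every automorphism of a commutative unital C⋆-algebra corresponds to a system on its character
space. -/
theorem exists_correspondsTo {A : Type u} [CommCStarAlgebra A] (α : A ≃⋆ₐ[ℂ] A) :
    ∃ τ : WeakDual.characterSpace ℂ A ≃ₜ WeakDual.characterSpace ℂ A, CorrespondsTo α τ := by
  let F := WeakDual.CharacterSpace.compContinuousMap (α : A →⋆ₐ[ℂ] A)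
  let G := WeakDual.CharacterSpace.compContinuousMap (α.symm : A →⋆ₐ[ℂ] A)
  refine ⟨⟨⟨F, G, fun χ => ?_, fun χ => ?_⟩, F.continuous, G.continuous⟩,
    gelfandStarTransform A, fun a => ?_⟩
  · ext a
    exact congrArg χ (α.apply_symm_apply a)
  · ext a
    exact congrArg χ (α.symm_apply_apply a)
  · ext χ
    rfl

section

variable {X : Type*} [TopologicalSpace X] [CompactSpace X] (U : Ultrafilter ℕ)
  {Y : Type*} [TopologicalSpace Y] [CompactSpace Y]

theorem norm_mk_le {A : Type*} [CommCStarAlgebra A] (a : ℕ →ᵇ A) {c : ℝ} (h : ∀ n, ‖a n‖ ≤ c) :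
    ‖Ideal.Quotient.mk (nullIdeal A U) a‖ ≤ c :=
  le_of_tendsto' (tendsto_norm_mk U a) h

/-- If the functions `a n` are bounded below on the clopen sets `E n`, then the zeros of their class
avoid the limit of the sets `E n`. -/
theorem apply_indicatorSeq_eq_zero (e : Ultrapower C(X, ℂ) U ≃⋆ₐ[ℂ] C(Y, ℂ)) {E : ℕ → Set X} 
    (hE : ∀ n, IsClopen (E n)) (a : ℕ →ᵇ C(X, ℂ)) {δ : ℝ} (hδ : 0 < δ) (ha : ∀ n, ∀ x ∈ E n, δ ≤ ‖a n x‖) {y : Y}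
    (hy : e (Ideal.Quotient.mk (nullIdeal C(X, ℂ) U) a) y = 0) :
    e (Ideal.Quotient.mk (nullIdeal C(X, ℂ) U) (indicatorSeq hE)) y = 0 := by
  -- With this `M`, the product of the indicator and `1 - M⁻¹ a* a` has norm at most `1 - M⁻¹ δ² <
  -- 1`. Where the class of `a` vanishes it takes the value of the projection, which is `0` or `1`,
  -- hence `0`.
  set M : ℝ := ‖a‖ ^ 2 + δ ^ 2
  have hM : 0 < M := by positivity
  set b : ℕ →ᵇ C(X, ℂ) := indicatorSeq hE * (1 - ((M⁻¹ : ℝ) : ℂ) • (star a * a)) with hb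
  have hbn : ∀ n, ‖b n‖ ≤ 1 - M⁻¹ * δ ^ 2 := by
    intro n
    have h0 : 0 ≤ 1 - M⁻¹ * δ ^ 2 := by
      rw [sub_nonneg, inv_mul_le_one₀ hM]
      exact le_add_of_nonneg_left (sq_nonneg _)
    rw [ContinuousMap.norm_le _ h0]
    intro x
    by_cases hx : x ∈ E n
    · have h1 : b n x = ((1 - M⁻¹ * ‖a n x‖ ^ 2 : ℝ) : ℂ) := by
        have h2 : b n x = indicatorMap (hE n) x *
            (1 - ((M⁻¹ : ℝ) : ℂ) * (starRingEnd ℂ (a n x) * a n x)) := rfl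
        rw [h2, indicatorMap_of_mem _ hx, Complex.conj_mul']
        push_cast; ring
      have h3 : ‖a n x‖ ≤ ‖a‖ := ((a n).norm_coe_le_norm x).trans (a.norm_coe_le_norm n)
      have h4 : M⁻¹ * ‖a n x‖ ^ 2 ≤ 1 := by
        rw [inv_mul_le_one₀ hM]
        have : ‖a n x‖ ^ 2 ≤ ‖a‖ ^ 2 := by gcongr
        have := sq_nonneg δ
        linarith
      rw [h1, Complex.norm_real, Real.norm_of_nonneg (by linarith)]
      have : δ ^ 2 ≤ ‖a n x‖ ^ 2 := by gcongr; exact ha n x hx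
      gcongr
    · have h2 : b n x = indicatorMap (hE n) x *
            (1 - ((M⁻¹ : ℝ) : ℂ) * (starRingEnd ℂ (a n x) * a n x)) := rfl
      rw [h2, indicatorMap_of_notMem _ hx, zero_mul, norm_zero]
      exact h0
  have hnorm : ‖e (Ideal.Quotient.mk (nullIdeal C(X, ℂ) U) b) y‖ < 1 := by
    refine ((e _).norm_coe_le_norm y).trans_lt ?_
    rw [StarAlgEquiv.norm_map]
    refine (norm_mk_le U b hbn).trans_lt ?_
    have : 0 < M⁻¹ * δ ^ 2 := by positivity
    linarith
  set p := e (Ideal.Quotient.mk (nullIdeal C(X, ℂ) U) (indicatorSeq hE)) with hp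
  have hpp : p y * p y = p y := by
    have : p * p = p := by rw [hp, ← map_mul, mk_indicatorSeq_mul_self]
    exact DFunLike.congr_fun this y
  have hval : e (Ideal.Quotient.mk (nullIdeal C(X, ℂ) U) b) y = p y := by
    have h1 : Ideal.Quotient.mk (nullIdeal C(X, ℂ) U) b =
        Ideal.Quotient.mk (nullIdeal C(X, ℂ) U) (indicatorSeq hE) * (1 - ((M⁻¹ : ℝ) : ℂ) •
          (star (Ideal.Quotient.mk (nullIdeal C(X, ℂ) U) a) *
            Ideal.Quotient.mk (nullIdeal C(X, ℂ) U) a)) := rfl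
    rw [h1, map_mul, map_sub, map_one, map_smul, map_mul]
    change p y * (1 - ((M⁻¹ : ℝ) : ℂ) * (_ * e (Ideal.Quotient.mk (nullIdeal C(X, ℂ) U) a) y)) = _
    rw [hy, mul_zero, mul_zero, sub_zero, mul_one]
  by_contra hne
  have h1 : p y = 1 := mul_right_cancel₀ hne (hpp.trans (one_mul _).symm)
  rw [hval, h1, norm_one] at hnorm
  exact lt_irrefl _ hnorm

/-- A function with values `0` and `1` at the two points is lifted to a sequence `a`. Clopen sets
between `‖a n‖ ≤ 1/3` and `‖a n‖ < 2/3` define a projection: `a` is bounded below off these sets, `1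
- a` on them, so the projection is `1` at the first point and `0` at the second. -/
theorem totallyDisconnectedSpace_of_ultrapower [T2Space X] [TotallyDisconnectedSpace X]
    [T2Space Y] (e : Ultrapower C(X, ℂ) U ≃⋆ₐ[ℂ] C(Y, ℂ)) : TotallyDisconnectedSpace Y := by
  suffices h : ∀ y₁ y₂ : Y, y₁ ≠ y₂ → ∃ D : Set Y, IsClopen D ∧ y₁ ∈ D ∧ y₂ ∉ D by
    have : TotallySeparatedSpace Y := totallySeparatedSpace_iff_exists_isClopen.2
      fun y₁ y₂ hne => h y₁ y₂ hne
    infer_instance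
  intro y₁ y₂ hne
  obtain ⟨f, hf1, hf2, -⟩ := exists_continuous_zero_one_of_isClosed
    (isClosed_singleton (x := y₁)) (isClosed_singleton (x := y₂)) (by simpa using hne)
  let F : C(Y, ℂ) := ⟨fun y => (f y : ℂ), by fun_prop⟩
  have hF1 : F y₁ = 0 := by simp [F, hf1 rfl]
  have hF2 : F y₂ = 1 := by simp [F, hf2 rfl]
  obtain ⟨a, ha⟩ := Ideal.Quotient.mk_surjective (e.symm F)
  have hea : e (Ideal.Quotient.mk (nullIdeal C(X, ℂ) U) a) = F := by
    rw [ha]; exact e.apply_symm_apply F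
  have hD : ∀ n, ∃ D : Set X, IsClopen D ∧ {x | ‖a n x‖ ≤ 1 / 3} ⊆ D ∧
      D ⊆ {x | ‖a n x‖ < 2 / 3} := fun n =>
    exists_clopen_of_closed_subset_open (isClosed_le (by fun_prop) continuous_const)
      (isOpen_lt (by fun_prop) continuous_const) fun x hx =>
      show ‖a n x‖ < 2 / 3 from lt_of_le_of_lt (Set.mem_ofPred_eq.mp hx) (by norm_num)
  choose D hD hD1 hD2 using hD
  have hDc : ∀ n, IsClopen (D n)ᶜ := fun n => (hD n).compl
  have h1 := apply_indicatorSeq_eq_zero U e hDc a (δ := 1 / 3) (by norm_num) (fun n x hx =>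
    le_of_not_ge fun h => hx (hD1 n h)) (y := y₁) (by rw [hea, hF1])
  have h2 := apply_indicatorSeq_eq_zero U e hD (1 - a) (δ := 1 / 3) (by norm_num) (fun n x hx => by
      have h3 : ‖a n x‖ < 2 / 3 := hD2 n hx
      have h4 : (1 - a) n x = 1 - a n x := rfl
      have h5 := norm_sub_norm_le (1 : ℂ) (a n x)
      rw [norm_one] at h5
      rw [h4]; linarith) (y := y₂) (by
      rw [map_sub, map_sub, hea, map_one, map_one, ContinuousMap.sub_apply, hF2]
      simp)
  have hsum : Ideal.Quotient.mk (nullIdeal C(X, ℂ) U) (indicatorSeq hD) +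
      Ideal.Quotient.mk (nullIdeal C(X, ℂ) U) (indicatorSeq hDc) = 1 := by
    rw [← map_add, ← map_one (Ideal.Quotient.mk (nullIdeal C(X, ℂ) U))]
    congr 1
    ext n x
    change indicatorMap (hD n) x + indicatorMap (hDc n) x = 1
    by_cases hx : x ∈ D n
    · rw [indicatorMap_of_mem _ hx, indicatorMap_of_notMem _ (by simpa using hx), add_zero]
    · rw [indicatorMap_of_notMem _ hx, indicatorMap_of_mem _ (by simpa using hx), zero_add]
  have h6 := DFunLike.congr_fun (congrArg e hsum) y₁
  rw [map_add, ContinuousMap.add_apply, h1, add_zero, map_one] at h6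
  refine ⟨_, isClopen_of_mul_self_eq
    (p := e (Ideal.Quotient.mk (nullIdeal C(X, ℂ) U) (indicatorSeq hD)))
    (by rw [← map_mul, mk_indicatorSeq_mul_self]), h6, fun h => ?_⟩
  rw [Set.mem_ofPred_eq, h2] at h
  exact zero_ne_one h

theorem exists_separating_map [T2Space X] [PerfectSpace X] (f : C(X, ℂ)) (hf : 1 / 2 < ‖f‖) :
    ∃ g : C(X, ℂ), ‖g‖ ≤ 1 ∧ ∃ x y, 1 / 2 ≤ ‖f x‖ ∧ 1 / 2 ≤ ‖f y‖ ∧ g x = 0 ∧ g y = 1 := by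
  obtain ⟨x, hx⟩ : ∃ x, 1 / 2 < ‖f x‖ := by
    by_contra! h
    exact absurd ((ContinuousMap.norm_le f (by norm_num)).2 h) (not_le.2 hf)
  have hopen : {z | 1 / 2 < ‖f z‖} ∈ 𝓝 x :=
    (isOpen_lt continuous_const (by fun_prop)).mem_nhds hx
  obtain ⟨y, hy, hyx⟩ : ∃ y, 1 / 2 < ‖f y‖ ∧ y ≠ x :=
    (Filter.Eventually.and (f := 𝓝[≠] x) (mem_nhdsWithin_of_mem_nhds hopen)
      self_mem_nhdsWithin).exists
  obtain ⟨g, hg1, hg2, hg⟩ := exists_continuous_zero_one_of_isClosed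
    (isClosed_singleton (x := x)) (isClosed_singleton (x := y)) (by simpa using hyx.symm)
  refine ⟨⟨fun z => (g z : ℂ), by fun_prop⟩, ?_, x, y, hx.le, hy.le, by simp [hg1 rfl],
    by simp [hg2 rfl]⟩
  rw [ContinuousMap.norm_le _ zero_le_one]
  intro z
  rw [ContinuousMap.coe_mk, Complex.norm_real, Real.norm_of_nonneg (hg z).1]
  exact (hg z).2

/-- An isolated point gives a nonzero projection on which every element acts as a scalar `c`. Since
`X` is perfect, some `g n` takes the values `0` and `1` at points where the representative `f n` is
at least `1/2` in norm, so `c` would be within `1/2` of both. -/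
theorem perfectSpace_of_ultrapower [T2Space X] [PerfectSpace X] [T2Space Y]
    (e : Ultrapower C(X, ℂ) U ≃⋆ₐ[ℂ] C(Y, ℂ)) : PerfectSpace Y := by
  rw [perfectSpace_iff_forall_not_isolated]
  intro y
  by_contra hy
  rw [Filter.not_neBot, ← isOpen_singleton_iff_punctured_nhds] at hy
  have hclopen : IsClopen ({y} : Set Y) := ⟨isClosed_singleton, hy⟩
  obtain ⟨f, hf⟩ := Ideal.Quotient.mk_surjective (e.symm (indicatorMap hclopen))
  have hef : e (Ideal.Quotient.mk (nullIdeal C(X, ℂ) U) f) = indicatorMap hclopen := by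
    rw [hf]; exact e.apply_symm_apply _
  have hf1 : 1 ≤ ‖Ideal.Quotient.mk (nullIdeal C(X, ℂ) U) f‖ := by
    rw [← StarAlgEquiv.norm_map e, hef]
    have := (indicatorMap hclopen).norm_coe_le_norm y
    rwa [indicatorMap_of_mem hclopen rfl, norm_one] at this
  have hg : ∀ n, ∃ g : C(X, ℂ), ‖g‖ ≤ 1 ∧ (1 / 2 < ‖f n‖ →
      ∃ x y, 1 / 2 ≤ ‖f n x‖ ∧ 1 / 2 ≤ ‖f n y‖ ∧ g x = 0 ∧ g y = 1) := by
    intro n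
    by_cases hn : 1 / 2 < ‖f n‖
    · obtain ⟨g, hg, h⟩ := exists_separating_map (f n) hn
      exact ⟨g, hg, fun _ => h⟩
    · exact ⟨0, by simp, fun h => absurd h hn⟩
  choose g hg hsep using hg
  set a := Ideal.Quotient.mk (nullIdeal C(X, ℂ) U) (boundedSeq g 1 hg)
  set c := e a y
  have hprod : Ideal.Quotient.mk (nullIdeal C(X, ℂ) U)
      ((boundedSeq g 1 hg - algebraMap ℂ _ c) * f) = 0 := by
    refine EquivLike.injective e ?_
    rw [map_mul, map_mul, hef, map_zero]
    have h1 : e (Ideal.Quotient.mk (nullIdeal C(X, ℂ) U)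
        (boundedSeq g 1 hg - algebraMap ℂ _ c)) = e a - algebraMap ℂ _ c := by
      rw [map_sub, map_sub]
      congr 1
      exact AlgHomClass.commutes e c
    rw [h1]
    ext z
    by_cases hz : z ∈ ({y} : Set Y)
    · obtain rfl : z = y := hz
      have : (e a - algebraMap ℂ C(Y, ℂ) c) z = 0 := sub_self c
      rw [ContinuousMap.mul_apply, this, zero_mul]
      rfl
    · rw [ContinuousMap.mul_apply, indicatorMap_of_notMem _ hz, mul_zero]
      rfl
  rw [Ideal.Quotient.eq_zero_iff_mem, mem_nullIdeal] at hprod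
  have hev1 : ∀ᶠ n in (U : Filter ℕ), 1 / 2 < ‖f n‖ :=
    (tendsto_norm_mk U f).eventually_const_lt (by linarith)
  obtain ⟨n, hn1, hn2⟩ := (hev1.and (hprod.eventually_lt_const (show (0 : ℝ) < 1 / 4 by
    norm_num))).exists
  obtain ⟨x, z, hx, hz, hgx, hgz⟩ := hsep n hn1
  have hpt : ∀ w, 1 / 2 ≤ ‖f n w‖ → ‖g n w - c‖ < 1 / 2 := by
    intro w hw
    have h1 := (((boundedSeq g 1 hg - algebraMap ℂ _ c) * f) n).norm_coe_le_norm w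
    have h2 : (((boundedSeq g 1 hg - algebraMap ℂ _ c) * f) n) w = (g n w - c) * f n w := by
      have : (algebraMap ℂ (ℕ →ᵇ C(X, ℂ)) c) n w = c := rfl
      change (g n w - (algebraMap ℂ (ℕ →ᵇ C(X, ℂ)) c) n w) * f n w = _
      rw [this]
    rw [h2, norm_mul] at h1
    have := norm_nonneg (g n w - c)
    nlinarith
  have h1 := hpt x hx
  have h2 := hpt z hz
  rw [hgx] at h1
  rw [hgz] at h2
  have h3 := norm_sub_le (1 - c) (0 - c)
  rw [show (1 - c) - (0 - c) = (1 : ℂ) by ring, norm_one] at h3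
  linarith

end

/-! ### Łoś's theorem -/

theorem abs_iSup_le_of_forall {ι : Type*} [Nonempty ι] {f : ι → ℝ} {C : ℝ} (h : ∀ i, |f i| ≤ C) :
    |⨆ i, f i| ≤ C := by
  have hb : BddAbove (Set.range f) := ⟨C, by rintro _ ⟨i, rfl⟩; exact (abs_le.1 (h i)).2⟩
  rw [abs_le]
  exact ⟨(abs_le.1 (h (Classical.arbitrary ι))).1.trans (le_ciSup hb _),
    ciSup_le fun i => (abs_le.1 (h i)).2⟩

/-- Valid without boundedness, by the definition of `sInf` on the reals; it reduces infimum
quantifiers to supremum quantifiers. -/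
theorem iInf_eq_neg_iSup_neg {ι : Type*} (f : ι → ℝ) : ⨅ i, f i = -⨆ i, -f i := by
  rw [iInf, iSup, Real.sInf_def]
  congr 2
  ext x
  simp only [Set.mem_neg, Set.mem_range]
  exact exists_congr fun i => neg_eq_iff_eq_neg.symm

/-- `h2` lifts near-maximizers of `g` and bounds the limit from below; `h1`, applied to
near-maximizers of the `f k`, bounds it from above. -/
theorem tendsto_iSup_of_forall_seq {l : Filter ℕ} {B B' : Type*} [Nonempty B] [Nonempty B']
    {f : ℕ → B → ℝ} {g : B' → ℝ} {C : ℝ} (hf : ∀ k b, |f k b| ≤ C) (hg : ∀ b, |g b| ≤ C)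
    (h1 : ∀ b : ℕ → B, ∃ b', Tendsto (fun k => f k (b k)) l (𝓝 (g b')))
    (h2 : ∀ b', ∃ b : ℕ → B, Tendsto (fun k => f k (b k)) l (𝓝 (g b'))) :
    Tendsto (fun k => ⨆ b, f k b) l (𝓝 (⨆ b', g b')) := by
  have hbf : ∀ k, BddAbove (Set.range (f k)) := fun k =>
    ⟨C, by rintro _ ⟨i, rfl⟩; exact (abs_le.1 (hf k i)).2⟩
  have hbg : BddAbove (Set.range g) := ⟨C, by rintro _ ⟨i, rfl⟩; exact (abs_le.1 (hg i)).2⟩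
  refine tendsto_order.2 ⟨fun c hc => ?_, fun c hc => ?_⟩
  · obtain ⟨b', hb'⟩ := exists_lt_of_lt_ciSup hc
    obtain ⟨b, hb⟩ := h2 b'
    filter_upwards [hb.eventually_const_lt hb'] with k hk
    exact hk.trans_le (le_ciSup (hbf k) (b k))
  · set ε := (c - ⨆ b', g b') / 2 with hε
    have hε0 : 0 < ε := half_pos (sub_pos.2 hc)
    have hex : ∀ k, ∃ b, (⨆ b, f k b) - ε < f k b := fun k =>
      exists_lt_of_lt_ciSup (sub_lt_self _ hε0)
    choose b hb using hex
    obtain ⟨b', hb'⟩ := h1 b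
    have hle : g b' < (⨆ b', g b') + ε := (le_ciSup hbg b').trans_lt (lt_add_of_pos_right _ hε0)
    filter_upwards [hb'.eventually_lt_const hle] with k hk
    have := hb k
    linarith

section

variable {A : Type*} [CommCStarAlgebra A] (α : A ≃⋆ₐ[ℂ] A)

instance (N : ℕ) : Nonempty (Metric.closedBall (0 : A) N) :=
  ⟨⟨0, Metric.mem_closedBall_self N.cast_nonneg⟩⟩

theorem Term.exists_bound {n : ℕ} (t : Term n) (r : ℝ) :
    ∃ C, ∀ v : Fin n → A, (∀ i, ‖v i‖ ≤ r) → ‖t.eval α v‖ ≤ C := by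
  induction t with
  | var i => exact ⟨r, fun v hv => hv i⟩
  | zero => exact ⟨0, fun v _ => norm_zero.le⟩
  | one => exact ⟨‖(1 : A)‖, fun v _ => le_rfl⟩
  | add s t hs ht =>
    obtain ⟨C, hC⟩ := hs
    obtain ⟨D, hD⟩ := ht
    exact ⟨C + D, fun v hv => (norm_add_le _ _).trans (add_le_add (hC v hv) (hD v hv))⟩
  | mul s t hs ht =>
    obtain ⟨C, hC⟩ := hs
    obtain ⟨D, hD⟩ := ht
    exact ⟨C * D, fun v hv => (norm_mul_le _ _).trans
      (mul_le_mul (hC v hv) (hD v hv) (norm_nonneg _) ((norm_nonneg _).trans (hC v hv)))⟩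
  | smul c t ht =>
    obtain ⟨C, hC⟩ := ht
    exact ⟨‖c‖ * C, fun v hv => (norm_smul_le _ _).trans
      (mul_le_mul_of_nonneg_left (hC v hv) (norm_nonneg _))⟩
  | star t ht =>
    obtain ⟨C, hC⟩ := ht
    exact ⟨C, fun v hv => (norm_star _).trans_le (hC v hv)⟩
  | sigma t ht =>
    obtain ⟨C, hC⟩ := ht
    exact ⟨C, fun v hv => (StarAlgEquiv.norm_map α _).trans_le (hC v hv)⟩

theorem norm_snoc_le {n : ℕ} {v : Fin n → A} {r : ℝ} (hv : ∀ i, ‖v i‖ ≤ r) {N : ℕ}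
    (a : Metric.closedBall (0 : A) N) (i : Fin (n + 1)) :
    ‖(Fin.snoc (α := fun _ => A) v (a : A) : Fin (n + 1) → A) i‖ ≤ max r N := by
  refine Fin.lastCases ?_ (fun i => ?_) i
  · rw [Fin.snoc_last]
    exact (mem_closedBall_zero_iff.1 a.2).trans (le_max_right _ _)
  · rw [Fin.snoc_castSucc]
    exact (hv i).trans (le_max_left _ _)

/-- Ensures that the suprema and infima in formulas are those of bounded families. A connective is
bounded because it is continuous on a compact box. -/
theorem Formula.exists_bound {n : ℕ} (φ : Formula n) (r : ℝ) :
    ∃ C, ∀ v : Fin n → A, (∀ i, ‖v i‖ ≤ r) → |φ.eval α v| ≤ C := by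
  induction φ generalizing r with
  | norm t =>
    obtain ⟨C, hC⟩ := t.exists_bound α r
    exact ⟨C, fun v hv => (abs_norm _).trans_le (hC v hv)⟩
  | connective f φ ih =>
    choose C hC using fun i => ih i r
    obtain ⟨D, hD⟩ := (isCompact_univ_pi fun i => isCompact_Icc (a := -C i) (b := C i))
      |>.exists_bound_of_continuousOn f.continuous.continuousOn
    exact ⟨D, fun v hv => hD _ fun i _ => abs_le.1 (hC i v hv)⟩
  | sup N φ ih =>
    obtain ⟨C, hC⟩ := ih (max r N)
    exact ⟨C, fun v hv => abs_iSup_le_of_forall fun a => hC _ (norm_snoc_le hv a)⟩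
  | inf N φ ih =>
    obtain ⟨C, hC⟩ := ih (max r N)
    refine ⟨C, fun v hv => ?_⟩
    rw [Formula.eval, iInf_eq_neg_iSup_neg, abs_neg]
    exact abs_iSup_le_of_forall fun a => (abs_neg _).trans_le (hC _ (norm_snoc_le hv a))

variable (U : Ultrafilter ℕ)

theorem Term.eval_mk {n : ℕ} (t : Term n) (v : Fin n → ℕ →ᵇ A) :
    ∃ w : ℕ →ᵇ A, (∀ k, w k = t.eval α fun i => v i k) ∧
      t.eval (ultrapowerAut U α) (fun i => Ideal.Quotient.mk (nullIdeal A U) (v i)) =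
        Ideal.Quotient.mk (nullIdeal A U) w := by
  induction t with
  | var i => exact ⟨v i, fun k => rfl, rfl⟩
  | zero => exact ⟨0, fun k => rfl, rfl⟩
  | one => exact ⟨1, fun k => rfl, rfl⟩
  | add s t hs ht =>
    obtain ⟨w, hw, h⟩ := hs
    obtain ⟨w', hw', h'⟩ := ht
    refine ⟨w + w', fun k => ?_, ?_⟩
    · rw [Term.eval, ← hw, ← hw']; rfl
    · rw [Term.eval, h, h', map_add]
  | mul s t hs ht =>
    obtain ⟨w, hw, h⟩ := hs
    obtain ⟨w', hw', h'⟩ := ht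
    refine ⟨w * w', fun k => ?_, ?_⟩
    · rw [Term.eval, ← hw, ← hw']; rfl
    · rw [Term.eval, h, h', map_mul]
  | smul c t ht =>
    obtain ⟨w, hw, h⟩ := ht
    refine ⟨c • w, fun k => ?_, ?_⟩
    · rw [Term.eval, ← hw]; rfl
    · rw [Term.eval, h]; rfl
  | star t ht =>
    obtain ⟨w, hw, h⟩ := ht
    refine ⟨Star.star w, fun k => ?_, ?_⟩
    · rw [Term.eval, ← hw]; rfl
    · rw [Term.eval, h, star_mk]
  | sigma t ht =>
    obtain ⟨w, hw, h⟩ := ht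
    refine ⟨mapSeq α w, fun k => ?_, ?_⟩
    · rw [Term.eval, ← hw]; rfl
    · rw [Term.eval, h, ultrapowerAut_mk]

/-- Radial scaling into the ball. It makes closed balls of the ultrapower consist of classes of
sequences in the same ball, as the quantifiers require. -/
theorem exists_norm_le_norm_sub_le (a : A) {N : ℝ} (hN : 0 ≤ N) :
    ∃ b : A, ‖b‖ ≤ N ∧ ‖a - b‖ ≤ max (‖a‖ - N) 0 := by
  by_cases h : ‖a‖ ≤ N
  · exact ⟨a, h, by simp⟩
  · have ha : 0 < ‖a‖ := hN.trans_lt (not_le.1 h)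
    have hr : 0 ≤ N / ‖a‖ := by positivity
    have hr1 : N / ‖a‖ ≤ 1 := by rw [div_le_one ha]; exact (not_le.1 h).le
    refine ⟨((N / ‖a‖ : ℝ) : ℂ) • a, ?_, le_max_of_le_left ?_⟩
    · rw [norm_smul, Complex.norm_real, Real.norm_of_nonneg hr, div_mul_cancel₀ _ ha.ne']
    · have : a - ((N / ‖a‖ : ℝ) : ℂ) • a = ((1 - N / ‖a‖ : ℝ) : ℂ) • a := by
        push_cast; rw [sub_smul, one_smul]
      rw [this, norm_smul, Complex.norm_real, Real.norm_of_nonneg (by linarith), sub_mul, one_mul,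
        div_mul_cancel₀ _ ha.ne']

/-- An element of the ultrapower is represented by a sequence obeying the same norm bound. -/
theorem exists_mk_eq_norm_le (x : Ultrapower A U) {N : ℝ} (hN : 0 ≤ N) (hx : ‖x‖ ≤ N) :
    ∃ b : ℕ →ᵇ A, (∀ k, ‖b k‖ ≤ N) ∧ Ideal.Quotient.mk (nullIdeal A U) b = x := by
  obtain ⟨a, rfl⟩ := Ideal.Quotient.mk_surjective x
  choose b hb hab using fun k => exists_norm_le_norm_sub_le (a k) hN
  refine ⟨boundedSeq b N hb, hb, ?_⟩
  symm
  rw [Ideal.Quotient.eq, mem_nullIdeal]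
  refine squeeze_zero (fun k => norm_nonneg _) hab ?_
  have := ((tendsto_norm_mk U a).sub_const N).max (tendsto_const_nhds (x := (0 : ℝ)))
  rwa [max_eq_right (sub_nonpos.2 hx)] at this

theorem snoc_seq_apply {n : ℕ} (v : Fin n → ℕ →ᵇ A) (b : ℕ →ᵇ A) (k : ℕ) :
    (Fin.snoc (α := fun _ => A) (fun i => v i k) (b k) : Fin (n + 1) → A) =
      fun i => (Fin.snoc (α := fun _ => ℕ →ᵇ A) v b : Fin (n + 1) → ℕ →ᵇ A) i k := by
  funext i
  refine Fin.lastCases ?_ (fun i => ?_) i <;> simp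

theorem snoc_mk {n : ℕ} (v : Fin n → ℕ →ᵇ A) (b : ℕ →ᵇ A) :
    (Fin.snoc (α := fun _ => Ultrapower A U)
      (fun i => Ideal.Quotient.mk (nullIdeal A U) (v i))
      (Ideal.Quotient.mk (nullIdeal A U) b) : Fin (n + 1) → Ultrapower A U) =
      fun i => Ideal.Quotient.mk (nullIdeal A U)
        ((Fin.snoc (α := fun _ => ℕ →ᵇ A) v b : Fin (n + 1) → ℕ →ᵇ A) i) := by
  funext i
  refine Fin.lastCases ?_ (fun i => ?_) i <;> simp

theorem tendsto_iSup_closedBall {n : ℕ} (N : ℕ) (F : (Fin (n + 1) → A) → ℝ)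
    (G : (Fin (n + 1) → Ultrapower A U) → ℝ)
    (hF : ∀ r : ℝ, ∃ C, ∀ v, (∀ i, ‖v i‖ ≤ r) → |F v| ≤ C)
    (hG : ∀ r : ℝ, ∃ C, ∀ v, (∀ i, ‖v i‖ ≤ r) → |G v| ≤ C)
    (hFG : ∀ v : Fin (n + 1) → ℕ →ᵇ A, Tendsto (fun k => F fun i => v i k) U
      (𝓝 (G fun i => Ideal.Quotient.mk (nullIdeal A U) (v i))))
    (v : Fin n → ℕ →ᵇ A) :
    Tendsto (fun k => ⨆ a : Metric.closedBall (0 : A) N, F (Fin.snoc (fun i => v i k) (a : A))) U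
      (𝓝 (⨆ a : Metric.closedBall (0 : Ultrapower A U) N,
        G (Fin.snoc (fun i => Ideal.Quotient.mk (nullIdeal A U) (v i)) (a : Ultrapower A U)))) := by
  obtain ⟨r, hr⟩ := Finite.exists_le fun i => ‖v i‖
  obtain ⟨C, hC⟩ := hF (max r N)
  obtain ⟨D, hD⟩ := hG (max r N)
  have hlim : ∀ b : ℕ →ᵇ A, Tendsto (fun k => F (Fin.snoc (fun i => v i k) (b k))) U
      (𝓝 (G (Fin.snoc (fun i => Ideal.Quotient.mk (nullIdeal A U) (v i))
        (Ideal.Quotient.mk (nullIdeal A U) b)))) := by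
    intro b
    simp only [snoc_seq_apply, snoc_mk]
    exact hFG _
  refine tendsto_iSup_of_forall_seq (C := max C D) (fun k a => ?_) (fun a => ?_) (fun b => ?_)
    fun b' => ?_
  · exact (hC _ (norm_snoc_le (fun i => ((v i).norm_coe_le_norm k).trans (hr i)) a)).trans
      (le_max_left _ _)
  · exact (hD _ (norm_snoc_le (fun i => norm_mk_le U (v i) fun k =>
      ((v i).norm_coe_le_norm k).trans (hr i)) a)).trans (le_max_right _ _)
  · have hb : ∀ k, ‖(b k : A)‖ ≤ N := fun k => mem_closedBall_zero_iff.1 (b k).2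
    exact ⟨⟨Ideal.Quotient.mk (nullIdeal A U) (boundedSeq (fun k => (b k : A)) N hb),
      mem_closedBall_zero_iff.2 (norm_mk_le U _ hb)⟩, hlim (boundedSeq (fun k => (b k : A)) N hb)⟩
  · obtain ⟨x, hx⟩ := b'
    obtain ⟨b, hb, rfl⟩ := exists_mk_eq_norm_le U x N.cast_nonneg (mem_closedBall_zero_iff.1 hx)
    exact ⟨fun k => ⟨b k, mem_closedBall_zero_iff.2 (hb k)⟩, hlim b⟩

/-- Łoś's theorem: the value of a formula in the ultrapower is the limit of its values along the
ultrafilter. -/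
theorem Formula.tendsto_eval {n : ℕ} (φ : Formula n) (v : Fin n → ℕ →ᵇ A) :
    Tendsto (fun k => φ.eval α fun i => v i k) U
      (𝓝 (φ.eval (ultrapowerAut U α) fun i => Ideal.Quotient.mk (nullIdeal A U) (v i))) := by
  induction φ with
  | norm t =>
    obtain ⟨w, hw, h⟩ := t.eval_mk α U v
    simp only [Formula.eval, h, ← hw]
    exact tendsto_norm_mk U w
  | connective f φ ih =>
    simp only [Formula.eval]
    exact (f.continuous.tendsto _).comp (tendsto_pi_nhds.2 fun i => ih i v)
  | sup N φ ih =>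
    simp only [Formula.eval]
    exact tendsto_iSup_closedBall U N (φ.eval α) (φ.eval (ultrapowerAut U α)) (φ.exists_bound α)
      (φ.exists_bound _) ih v
  | inf N φ ih =>
    simp only [Formula.eval, iInf_eq_neg_iSup_neg]
    refine (tendsto_iSup_closedBall U N (fun v => -φ.eval α v)
      (fun v => -φ.eval (ultrapowerAut U α) v) (fun r => ?_) (fun r => ?_)
      (fun v => (ih v).neg) v).neg
    · simpa only [abs_neg] using φ.exists_bound α r
    · simpa only [abs_neg] using φ.exists_bound (ultrapowerAut U α) r

theorem Models.ultrapowerAut {T : Set Sentence} (h : Models α T) :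
    Models (ultrapowerAut U α) T := by
  intro φ hφ
  have hlim := φ.tendsto_eval α U Fin.elim0
  have h0 : ∀ k : ℕ, (φ.eval α fun i => (Fin.elim0 i : ℕ →ᵇ A) k) = 0 := fun k => by
    rw [← h φ hφ]; congr 1; exact Subsingleton.elim _ _
  simp only [h0] at hlim
  rw [tendsto_nhds_unique (tendsto_const_nhds (x := (0 : ℝ))) hlim]
  congr 1
  exact Subsingleton.elim _ _

end

/-! ### Invariance of formulas under isomorphism -/

section

variable {A B : Type*} [CommCStarAlgebra A] [CommCStarAlgebra B] {α : A ≃⋆ₐ[ℂ] A}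
  {β : B ≃⋆ₐ[ℂ] B} (e : A ≃⋆ₐ[ℂ] B)

/-- A star isomorphism restricts to the closed balls about the origin. -/
def closedBallEquiv (N : ℕ) : Metric.closedBall (0 : A) N ≃ Metric.closedBall (0 : B) N :=
  (EquivLike.toEquiv e).subtypeEquiv fun a => by
    rw [mem_closedBall_zero_iff, mem_closedBall_zero_iff]
    exact iff_of_eq (congrArg (· ≤ (N : ℝ)) (StarAlgEquiv.norm_map e a).symm)

variable {e}

theorem Term.eval_equiv (he : ∀ a, e (α a) = β (e a)) {n : ℕ} (t : Term n)
    (v : Fin n → A) : t.eval β (fun i => e (v i)) = e (t.eval α v) := by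
  induction t with
  | var i => rfl
  | zero => exact (map_zero e).symm
  | one => exact (map_one e).symm
  | add s t hs ht => rw [Term.eval, Term.eval, hs, ht, map_add]
  | mul s t hs ht => rw [Term.eval, Term.eval, hs, ht, map_mul]
  | smul c t ht => rw [Term.eval, Term.eval, ht, map_smul]
  | star t ht => rw [Term.eval, Term.eval, ht, map_star]
  | sigma t ht => rw [Term.eval, Term.eval, ht, he]

theorem snoc_equiv {n : ℕ} (v : Fin n → A) {N : ℕ} (a : Metric.closedBall (0 : A) N) :
    (Fin.snoc (α := fun _ => B) (fun i => e (v i)) (closedBallEquiv e N a : B) :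
      Fin (n + 1) → B) =
      fun i => e ((Fin.snoc (α := fun _ => A) v (a : A) : Fin (n + 1) → A) i) := by
  funext i
  refine Fin.lastCases ?_ (fun i => ?_) i
  · simp only [Fin.snoc_last]; rfl
  · simp only [Fin.snoc_castSucc]

theorem Formula.eval_equiv (he : ∀ a, e (α a) = β (e a)) {n : ℕ} (φ : Formula n)
    (v : Fin n → A) : φ.eval β (fun i => e (v i)) = φ.eval α v := by
  induction φ with
  | norm t =>
    rw [Formula.eval, Formula.eval, Term.eval_equiv he]
    exact StarAlgEquiv.norm_map e _
  | connective f φ ih => simp only [Formula.eval, ih]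
  | sup N φ ih =>
    symm
    refine Equiv.iSup_congr (closedBallEquiv e N) fun a => ?_
    rw [snoc_equiv, ih]
  | inf N φ ih =>
    symm
    refine Equiv.iInf_congr (closedBallEquiv e N) fun a => ?_
    rw [snoc_equiv, ih]

theorem Models.equiv (he : ∀ a, e (α a) = β (e a)) {T : Set Sentence}
    (h : Models α T) : Models β T := by
  intro φ hφ
  rw [← h φ hφ, ← Formula.eval_equiv he]
  congr 1
  exact Subsingleton.elim _ _

end

/-! ### Cantor sets -/

instance : PerfectSpace (ℕ → Bool) := by
  rw [perfectSpace_iff_forall_not_isolated]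
  intro x
  have hlim : Tendsto (fun k => Function.update x k (!x k)) atTop (𝓝[≠] x) := by
    refine tendsto_nhdsWithin_iff.2 ⟨tendsto_pi_nhds.2 fun i => ?_, .of_forall fun k h => ?_⟩
    · refine tendsto_const_nhds.congr' ?_
      filter_upwards [eventually_gt_atTop i] with k hk
      rw [Function.update_of_ne hk.ne]
    · have := congrFun h k
      simp at this
  exact hlim.neBot

theorem _root_.Homeomorph.perfectSpace {X Y : Type*} [TopologicalSpace X] [TopologicalSpace Y]
    [PerfectSpace Y] (h : X ≃ₜ Y) : PerfectSpace X := by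
  rw [perfectSpace_iff_forall_not_isolated]
  intro x
  by_contra hx
  rw [Filter.not_neBot, ← isOpen_singleton_iff_punctured_nhds, ← h.isOpen_image,
    Set.image_singleton, isOpen_singleton_iff_punctured_nhds] at hx
  exact (PerfectSpace.not_isolated (h x)).ne hx

/-- An ultrapower of a system on a Cantor set corresponds to a system of the same kind. -/
theorem exists_ultrapower_system {X : Type u} [TopologicalSpace X] [CompactSpace X] [T2Space X]
    [TotallyDisconnectedSpace X] [PerfectSpace X] (σ : X ≃ₜ X) (U : Ultrafilter ℕ) :
    ∃ (Y : Type u) (_ : TopologicalSpace Y) (_ : CompactSpace Y) (_ : T2Space Y)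
      (_ : TotallyDisconnectedSpace Y) (_ : PerfectSpace Y) (τ : Y ≃ₜ Y),
      CorrespondsTo (ultrapowerAut U (inducedAut σ)) τ := by
  obtain ⟨τ, hτ⟩ := exists_correspondsTo (ultrapowerAut U (inducedAut σ))
  obtain ⟨e, -⟩ := id hτ
  exact ⟨_, inferInstance, inferInstance, inferInstance,
    totallyDisconnectedSpace_of_ultrapower U e, perfectSpace_of_ultrapower U e, τ, hτ⟩

/-- A point of `X` gives a character of the ultrapower, so `1 ≠ 0` there, whereas `C(Y, ℂ)` is
trivial for empty `Y`. -/
theorem CorrespondsTo.nonempty {X : Type*} [TopologicalSpace X] [CompactSpace X] [Nonempty X]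
    {U : Ultrafilter ℕ} {α : Ultrapower C(X, ℂ) U ≃⋆ₐ[ℂ] Ultrapower C(X, ℂ) U} {Y : Type*}
    [TopologicalSpace Y] [CompactSpace Y] {τ : Y ≃ₜ Y} (h : CorrespondsTo α τ) : Nonempty Y := by
  obtain ⟨e, -⟩ := h
  by_contra hY
  rw [not_nonempty_iff] at hY
  obtain ⟨χ, -⟩ := exists_character U (Classical.arbitrary X)
  have h01 : (1 : Ultrapower C(X, ℂ) U) = 0 := EquivLike.injective e (Subsingleton.elim _ _)
  have := congrArg χ h01
  rw [map_one, map_zero] at this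
  exact one_ne_zero this

/-- A theory axiomatizing the property would hold for the inverse limit of the spirals, hence for
its ultrapower and the system of the ultrapower, which lacks the property. -/
theorem not_isAxiomatizableOverCantorA :
    ¬ IsAxiomatizableOverCantorA.{u} fun _ _ τ => TopLiftingProperty τ := by
  rintro ⟨T, hT⟩
  obtain ⟨σ, hσ⟩ := SpiralLimit.exists_shift.{u}
  have hlift := SpiralLimit.topLiftingProperty σ hσ
  have hU : ∀ n : ℕ, hyperfilter ℕ ≠ pure n := by
    intro n h
    have h1 : ({n} : Set ℕ) ∈ hyperfilter ℕ := by
      rw [h]; exact Set.mem_singleton n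
    exact (Set.finite_singleton n).notMem_hyperfilter h1
  obtain ⟨Y, _, _, _, _, _, τ, hτ⟩ := exists_ultrapower_system σ (hyperfilter ℕ)
  have := hτ.nonempty
  refine not_topLiftingProperty_of_correspondsTo (hyperfilter ℕ) hlift.1 hU hτ ((hT Y τ).1 ?_)
  obtain ⟨e, he⟩ := hτ
  exact (((hT _ σ).2 hlift).ultrapowerAut _ (hyperfilter ℕ)).equiv he

end

end CantorDynamics

theorem theorem3p4 :
    (∀ (X : Type u) [MetricSpace X] [CompactSpace X],
      Nonempty (X ≃ₜ (ℕ → Bool)) →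
      ∀ σ : X ≃ₜ X, CantorDynamics.LiftingProperty σ →
      ∀ U : Ultrafilter ℕ, (∀ n : ℕ, U ≠ pure n) →
        (∃ (Y : Type u) (_ : TopologicalSpace Y) (_ : CompactSpace Y) (_ : T2Space Y)
            (_ : TotallyDisconnectedSpace Y) (_ : PerfectSpace Y) (τ : Y ≃ₜ Y),
          CantorDynamics.CorrespondsTo
            (CantorDynamics.ultrapowerAut U (CantorDynamics.inducedAut σ)) τ ∧
          ¬ CantorDynamics.TopLiftingProperty τ) ∧
        (∀ (Y : Type v) [TopologicalSpace Y] [CompactSpace Y] [T2Space Y] (τ : Y ≃ₜ Y),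
          CantorDynamics.CorrespondsTo
            (CantorDynamics.ultrapowerAut U (CantorDynamics.inducedAut σ)) τ →
          ¬ CantorDynamics.TopLiftingProperty τ)) ∧
    ¬ CantorDynamics.IsAxiomatizableOverCantorA.{u}
        (fun _ _ τ => CantorDynamics.TopLiftingProperty τ) := by
  refine ⟨?_, CantorDynamics.not_isAxiomatizableOverCantorA⟩
  rintro X _ _ ⟨h⟩ σ hσ U hU
  have := h.symm.totallyDisconnectedSpace
  have := h.perfectSpace
  refine ⟨?_, fun Y _ _ _ τ hτ =>
    CantorDynamics.not_topLiftingProperty_of_correspondsTo U hσ.1 hU hτ⟩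
  obtain ⟨Y, h1, h2, h3, h4, h5, τ, hτ⟩ := CantorDynamics.exists_ultrapower_system σ U
  exact ⟨Y, h1, h2, h3, h4, h5, τ, hτ,
    CantorDynamics.not_topLiftingProperty_of_correspondsTo U hσ.1 hU hτ⟩
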